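/- For $d>0$ let $\mathcal D_d=\{z\in\mathbb C:|\operatorname{Im}z|<d\}$. A *weight function* on $\mathcal D_d$ is an analytic function $\omega:\mathcal D_d\to\mathbb C$ without zeros such that $$\lim_{x\to\pm\infty}\int_{-d}^{d}|\omega(x+iy)|\,dy=0,\qquad \lim_{y\nearrow d}\int_{-\infty}^{\infty}\bigl(|\omega(x+iy)|+|\omega(x-iy)|\bigr)\,dx \ \text{ exists and is finite,}$$ and such that on the real line $\omega$ is real with values in $(0,1]$, even, and non-increasing on $[0,\infty)$. It is of *single-exponential (SE) type* with parameters $\alpha_1,\alpha_2,\beta>0$, $\rho\ge 1$ if $$\alpha_1\exp(-(\beta|x|)^{\rho})\le\omega(x)\le\alpha_2\exp(-(\beta|x|)^{\rho})\qquad(x\in\mathbb R),$$ and of *double-exponential (DE) type* with parameters $\alpha_1,\alpha_2,\beta_1,\beta_2,\gamma>0$, $\beta_1\ge\beta_2$, if $$\alpha_1\exp(-\beta_1\exp(\gamma|x|))\le\omega(x)\le\alpha_2\exp(-\beta_2\exp(\gamma|x|))\qquad(x\in\mathbb R).$$ Let $H^\infty(\mathcal D_d,\omega)$ be the space of analytic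 functions $f:\mathcal D_d\to\mathbb C$ with $\|f\|:=\sup_{z\in\mathcal D_d}|f(z)/\omega(z)|<\infty$. The worst-case error of a quadrature rule $A$ is $$e^{\mathrm{wor}}(A,H^\infty(\mathcal D_d,\omega))=\sup_{\|f\|\le 1}\Bigl|A(f)-\int_{-\infty}^{\infty}f(x)\,dx\Bigr| .$$ A finite set $S\subset[-1,1]$ of nodes gives the interpolatory rule $\sum_{x\in S}w_x f(x)$ on $[-1,1]$, where $w_x=\int_{-1}^{1}\ell_x(t)\,dt$ and $\ell_x$ is the Lagrange basis polynomial of the node $x$; scaled to $[-T,T]$ it becomes $f\mapsto\sum_{x\in S}T\,w_x f(Tx)$. The $n$-point Gauss–Legendre rule is the interpolatory rule whose nodes are the zeros of the Legendre polynomial $P_n$. The $n$-point Clenshaw–Curtis rule ($n\ge2$) is the interpolatory rule with nodes $\cos\frac{k\pi}{n-1}$, $0\le k\le n-1$. **Theorem.** Let $d>0$, let $\omega$ be a weight function on $\mathcal D_d$, and let $L>0$. For $n\ge 2$ let $A_n$ be either the $n$-point Gauss–Legendre or the $n$-point Clenshaw–Curtis quadrature, scaled from $[-1,1]$ to $[-T,T]$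 with $T=T_n$ given below. 1. If $\omega$ is of SE type with parameters as above and $T=L\,n^{1/(\rho+1)}$, then there are constants $C,K>0$, independent of $n$, such that for all $n\ge 2$ $$e^{\mathrm{wor}}(A_n,H^\infty(\mathcal D_d,\omega))\le K\exp\bigl(-C\,n^{\rho/(\rho+1)}\bigr).$$ 2. If $\omega$ is of DE type with parameters as above, $\gamma L\ge 1$ and $T=L\ln n$, then there are constants $C,K>0$, independent of $n$, such that for all $n\ge2$ $$e^{\mathrm{wor}}(A_n,H^\infty(\mathcal D_d,\omega))\le K\exp\bigl(-C\,n/\ln n\bigr).$$ -/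

import Mathlib

open Set Filter Topology MeasureTheory
open scoped ENNReal

/-! ### Functions on the strip -/

/-- The strip `D_d = {z : |Im z| < d}`. -/
def strip (d : ℝ) : Set ℂ := {z | |z.im| < d}

/-- The class `B(D_d)`: functions analytic in the strip whose integrals over vertical cross sections
tend to `0` at both ends, and for which the integrals over the two horizontal lines `Im z = ± y`
have a finite limit as `y ↗ d`. Lebesgue integrals in `[0, ∞]` are used, so that no integrability
is presupposed. -/
structure IsClassB (d : ℝ) (ω : ℂ → ℂ) : Prop where
  analytic : AnalyticOnNhd ℂ ω (strip d)
  vertical_atTop : Tendsto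
    (fun x : ℝ => ∫⁻ y in Ioo (-d) d, ‖ω ((x : ℂ) + (y : ℂ) * Complex.I)‖ₑ) atTop (𝓝 0)
  vertical_atBot : Tendsto
    (fun x : ℝ => ∫⁻ y in Ioo (-d) d, ‖ω ((x : ℂ) + (y : ℂ) * Complex.I)‖ₑ) atBot (𝓝 0)
  horizontal : ∃ l : ℝ≥0∞, l < ∞ ∧ Tendsto
    (fun y : ℝ => ∫⁻ x : ℝ, (‖ω ((x : ℂ) + (y : ℂ) * Complex.I)‖ₑ
      + ‖ω ((x : ℂ) - (y : ℂ) * Complex.I)‖ₑ)) (𝓝[<] d) (𝓝 l)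

/-- Weight functions on the strip: members of `B(D_d)` without zeros in the strip which, on the
real line, are real with values in `(0, 1]`, even, and monotonically decreasing away from `0`. -/
structure IsWeightFunction (d : ℝ) (ω : ℂ → ℂ) : Prop where
  classB : IsClassB d ω
  ne_zero : ∀ z ∈ strip d, ω z ≠ 0
  im_eq_zero : ∀ x : ℝ, (ω (x : ℂ)).im = 0
  pos : ∀ x : ℝ, 0 < (ω (x : ℂ)).re
  le_one : ∀ x : ℝ, (ω (x : ℂ)).re ≤ 1
  even : ∀ x : ℝ, ω ((-x : ℝ) : ℂ) = ω (x : ℂ)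
  antitone : AntitoneOn (fun x : ℝ => (ω (x : ℂ)).re) (Ici 0)

/-- Single-exponential decay on the real line, with its parameters. -/
structure IsSEType (ω : ℂ → ℂ) (α₁ α₂ β ρ : ℝ) : Prop where
  alpha₁_pos : 0 < α₁
  alpha₂_pos : 0 < α₂
  beta_pos : 0 < β
  one_le_rho : 1 ≤ ρ
  lower : ∀ x : ℝ, α₁ * Real.exp (-(β * |x|) ^ ρ) ≤ (ω (x : ℂ)).re
  upper : ∀ x : ℝ, (ω (x : ℂ)).re ≤ α₂ * Real.exp (-(β * |x|) ^ ρ)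

/-- Double-exponential decay on the real line, with its parameters. -/
structure IsDEType (ω : ℂ → ℂ) (α₁ α₂ β₁ β₂ γ : ℝ) : Prop where
  alpha₁_pos : 0 < α₁
  alpha₂_pos : 0 < α₂
  beta₁_pos : 0 < β₁
  beta₂_pos : 0 < β₂
  gamma_pos : 0 < γ
  beta₂_le_beta₁ : β₂ ≤ β₁
  lower : ∀ x : ℝ, α₁ * Real.exp (-(β₁ * Real.exp (γ * |x|))) ≤ (ω (x : ℂ)).re
  upper : ∀ x : ℝ, (ω (x : ℂ)).re ≤ α₂ * Real.exp (-(β₂ * Real.exp (γ * |x|)))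

/-- The norm `sup_{z ∈ D_d} |f(z) / ω(z)|`, as an element of `[0, ∞]`. -/
noncomputable def hardyNorm (d : ℝ) (ω f : ℂ → ℂ) : ℝ≥0∞ :=
  ⨆ z ∈ strip d, ‖f z / ω z‖ₑ

/-- The weighted Hardy space `H^∞(D_d, ω)`. Only the values of `f` on the strip matter. -/
def hardySpace (d : ℝ) (ω : ℂ → ℂ) : Set (ℂ → ℂ) :=
  {f | AnalyticOnNhd ℂ f (strip d) ∧ hardyNorm d ω f < ∞}

/-- The worst-case error `sup |A(f) - ∫ f(x) dx|` over the unit ball of `H^∞(D_d, ω)`, as an element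
of `[0, ∞]`. For `ω` of single- or double-exponential type each such `f` is integrable over the
real line, see `IsSEType.integrable` and `IsDEType.integrable` below. -/
noncomputable def worstCaseError (d : ℝ) (ω : ℂ → ℂ) (A : (ℂ → ℂ) → ℂ) : ℝ≥0∞ :=
  ⨆ f ∈ {f | f ∈ hardySpace d ω ∧ hardyNorm d ω f ≤ 1}, ‖A f - ∫ x : ℝ, f (x : ℂ)‖ₑ

/-! ### Quadrature rules -/

/-- The weight at `x ∈ s` of the interpolatory quadrature rule on `[-1, 1]` with set of nodes `s`:
the integral of the Lagrange basis polynomial of `x`. -/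
noncomputable def interpolatoryWeight (s : Finset ℝ) (x : ℝ) : ℝ :=
  ∫ t in (-1 : ℝ)..1, (Lagrange.basis s id x).eval t

/-- The interpolatory rule on `[-1, 1]` with set of nodes `s`, scaled to `[-T, T]`. -/
noncomputable def scaledQuadrature (s : Finset ℝ) (T : ℝ) (f : ℂ → ℂ) : ℂ :=
  ∑ x ∈ s, ((T * interpolatoryWeight s x : ℝ) : ℂ) * f ((T * x : ℝ) : ℂ)

/-- The Legendre polynomial `P_n = (2^n n!)⁻¹ (d/dx)^n (x² - 1)^n`. -/
noncomputable def legendrePoly (n : ℕ) : Polynomial ℝ :=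
  Polynomial.C ((2 ^ n * (n.factorial : ℝ))⁻¹) *
    Polynomial.derivative^[n] ((Polynomial.X ^ 2 - 1) ^ n)

/-- The nodes of `n`-point Gauss–Legendre quadrature: the zeros of `P_n`. -/
noncomputable def gaussLegendreNodes (n : ℕ) : Finset ℝ :=
  (legendrePoly n).roots.toFinset

/-- The nodes of `n`-point Clenshaw–Curtis quadrature, `n ≥ 2`: the points `cos (k π / (n - 1))`
for `0 ≤ k ≤ n - 1`. -/
noncomputable def clenshawCurtisNodes (n : ℕ) : Finset ℝ :=
  (Finset.range n).image (fun k : ℕ => Real.cos ((k : ℝ) * Real.pi / ((n : ℝ) - 1)))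

/-- `n`-point Gauss–Legendre quadrature, scaled from `[-1, 1]` to `[-T, T]`. -/
noncomputable def gaussLegendre (n : ℕ) (T : ℝ) (f : ℂ → ℂ) : ℂ :=
  scaledQuadrature (gaussLegendreNodes n) T f

/-- `n`-point Clenshaw–Curtis quadrature, scaled from `[-1, 1]` to `[-T, T]`. -/
noncomputable def clenshawCurtis (n : ℕ) (T : ℝ) (f : ℂ → ℂ) : ℂ :=
  scaledQuadrature (clenshawCurtisNodes n) T f

/-! ### The integrals in the worst-case error exist -/

theorem integrable_of_exp_bound {d : ℝ} (hd : 0 < d) {ω f : ℂ → ℂ} (hω : IsWeightFunction d ω)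
    (hf : f ∈ hardySpace d ω) {K c : ℝ} (hc : 0 < c)
    (h : ∀ x : ℝ, (ω (x : ℂ)).re ≤ K * Real.exp (-c * |x|)) :
    Integrable (fun x : ℝ => f (x : ℂ)) := by
  have hmem : ∀ x : ℝ, (x : ℂ) ∈ strip d := fun x => by simpa [strip] using hd
  have hcont : Continuous (fun x : ℝ => f (x : ℂ)) := by
    rw [continuous_iff_continuousAt]
    intro x
    exact ContinuousAt.comp (f := fun x : ℝ => (x : ℂ)) (hf.1 _ (hmem x)).continuousAt
      Complex.continuous_ofReal.continuousAt
  have hexp : Integrable (fun x : ℝ => Real.exp (-c * |x|)) := by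
    rw [← integrableOn_univ, ← Iic_union_Ioi (a := (0 : ℝ))]
    refine IntegrableOn.union ?_ ?_
    · refine (integrableOn_exp_mul_Iic hc 0).congr_fun (fun x hx => ?_) measurableSet_Iic
      simp [abs_of_nonpos (show x ≤ 0 from hx)]
    · refine (integrableOn_exp_mul_Ioi (neg_lt_zero.2 hc) 0).congr_fun (fun x hx => ?_)
        measurableSet_Ioi
      simp [abs_of_pos (show 0 < x from hx)]
  refine ((hexp.const_mul K).const_mul (hardyNorm d ω f).toReal).mono'
    hcont.aestronglyMeasurable (Eventually.of_forall fun x => ?_)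
  have hn : ‖ω (x : ℂ)‖ = (ω (x : ℂ)).re := by
    have : ω (x : ℂ) = (((ω (x : ℂ)).re : ℝ) : ℂ) := Complex.ext (by simp) (by simp [hω.im_eq_zero x])
    rw [this, Complex.norm_real, Real.norm_of_nonneg (by simpa using (hω.pos x).le)]
    simp
  have h1 : ‖f (x : ℂ) / ω (x : ℂ)‖ ≤ (hardyNorm d ω f).toReal := by
    have : ‖f (x : ℂ) / ω (x : ℂ)‖ₑ ≤ hardyNorm d ω f :=
      le_iSup₂ (f := fun z (_ : z ∈ strip d) => ‖f z / ω z‖ₑ) (x : ℂ) (hmem x)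
    have := ENNReal.toReal_mono hf.2.ne this
    simpa using this
  rw [norm_div, hn, div_le_iff₀ (hω.pos x)] at h1
  exact h1.trans (mul_le_mul_of_nonneg_left (h x) ENNReal.toReal_nonneg)

theorem IsSEType.integrable {d : ℝ} (hd : 0 < d) {ω f : ℂ → ℂ} (hω : IsWeightFunction d ω)
    {α₁ α₂ β ρ : ℝ} (h : IsSEType ω α₁ α₂ β ρ) (hf : f ∈ hardySpace d ω) :
    Integrable (fun x : ℝ => f (x : ℂ)) := by
  refine integrable_of_exp_bound hd hω hf (K := α₂ * Real.exp 1) h.beta_pos fun x => ?_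
  refine (h.upper x).trans ?_
  rw [mul_assoc, ← Real.exp_add]
  refine mul_le_mul_of_nonneg_left (Real.exp_le_exp.2 ?_) h.alpha₂_pos.le
  have hb : 0 ≤ β * |x| := mul_nonneg h.beta_pos.le (abs_nonneg x)
  rcases le_total (β * |x|) 1 with h1 | h1
  · have := Real.rpow_nonneg hb ρ
    linarith
  · have := Real.self_le_rpow_of_one_le h1 h.one_le_rho
    linarith

theorem IsDEType.integrable {d : ℝ} (hd : 0 < d) {ω f : ℂ → ℂ} (hω : IsWeightFunction d ω)
    {α₁ α₂ β₁ β₂ γ : ℝ} (h : IsDEType ω α₁ α₂ β₁ β₂ γ) (hf : f ∈ hardySpace d ω) :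
    Integrable (fun x : ℝ => f (x : ℂ)) := by
  refine integrable_of_exp_bound hd hω hf (K := α₂) (mul_pos h.beta₂_pos h.gamma_pos) fun x => ?_
  refine (h.upper x).trans ?_
  refine mul_le_mul_of_nonneg_left (Real.exp_le_exp.2 ?_) h.alpha₂_pos.le
  have h1 := Real.add_one_le_exp (γ * |x|)
  have := mul_le_mul_of_nonneg_left (show γ * |x| ≤ Real.exp (γ * |x|) by linarith) h.beta₂_pos.le
  linarith

/-! The error splits into truncation to `[-T, T]` and quadrature error there. With `ω` bounded by `α
* exp (-E |x|)` on the real line, truncation costs `O(exp (-E T / 2))`. For the quadrature error,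
`f` in the unit ball satisfies `|f| ≤ |ω|`, and `ω` is bounded on the half-width strip, because
small integrals over vertical sections control point values by the mean value property. The map `z ↦
T * cos z` sends `|Im z| ≤ r / T` into that strip, so Fourier expansion of the periodic function `f
(T * cos z)` gives Chebyshev approximation of `f (T * x)` on `[-1, 1]` with error `O(T * exp (-r * n
/ T))`. An `n`-point interpolatory rule is exact for polynomials of degree less than `n`, hence
loses at most a factor of order `T` times `2` plus the sum of the absolute weights. That sum is `2`
for Gauss–Legendre, by positivity, and at most `4 * n` for Clenshaw–Curtis. The given `T` make both
`n / T` and `E T` at least a multiple of the claimed rate `m n`; powers of `n` are absorbed by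
giving up part of the exponent. -/

/-! ### Legendre polynomials: orthogonality and zeros -/

-- Integrate by parts `k` times. Derivatives of order below `n` still contain a factor `X ^ 2 - 1`,
-- so boundary terms vanish, while each step lowers the degree of `q`.
open Polynomial in
theorem integral_iterate_derivative_mul_eq_zero {n : ℕ} (k : ℕ) (hk : k ≤ n) :
    ∀ q : Polynomial ℝ, q.degree < k →
      ∫ t in (-1 : ℝ)..1, (derivative^[k] ((X ^ 2 - 1 : Polynomial ℝ) ^ n) * q).eval t = 0 := by
  induction k with
  | zero =>
    intro q hq
    have : q = 0 := by
      rw [← degree_eq_bot]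
      simpa using hq
    simp [this]
  | succ k ih =>
    intro q hq
    set w : Polynomial ℝ := derivative^[k] ((X ^ 2 - 1 : Polynomial ℝ) ^ n) with hw
    have hdvd : (X ^ 2 - 1 : Polynomial ℝ) ∣ w := by
      refine (dvd_pow_self _ (n := n - k) (by omega)).trans ?_
      exact Polynomial.pow_sub_dvd_iterate_derivative_pow _ n k
    have h1 : w.eval 1 = 0 := by
      obtain ⟨r, hr⟩ := hdvd
      simp [hr]
    have h2 : w.eval (-1) = 0 := by
      obtain ⟨r, hr⟩ := hdvd
      simp [hr]
    have hq' : (derivative q).degree < k := by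
      rcases eq_or_ne q 0 with rfl | h0
      · simp
      · have := degree_derivative_lt h0
        rw [degree_eq_natDegree h0] at this hq
        have h3 : q.natDegree ≤ k := by
          have : q.natDegree < k + 1 := by exact_mod_cast hq
          omega
        exact this.trans_le (by exact_mod_cast h3)
    have hibp := intervalIntegral.integral_mul_deriv_eq_deriv_mul (a := (-1 : ℝ)) (b := 1)
      (u := fun t => q.eval t) (u' := fun t => (derivative q).eval t)
      (v := fun t => w.eval t) (v' := fun t => (derivative w).eval t)
      (fun t _ => q.hasDerivAt t) (fun t _ => w.hasDerivAt t)
      ((derivative q).continuous.intervalIntegrable _ _)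
      ((derivative w).continuous.intervalIntegrable _ _)
    rw [Function.iterate_succ_apply', ← hw]
    have h4 := ih (by omega) _ hq'
    simp only [eval_mul] at h4 ⊢
    simp only [h1, h2, mul_zero, sub_zero, zero_sub] at hibp
    calc _ = ∫ t in (-1 : ℝ)..1, q.eval t * (derivative w).eval t := by simp only [mul_comm]
      _ = _ := by rw [hibp, neg_eq_zero, ← h4]; simp only [mul_comm]

theorem integral_legendrePoly_mul_eq_zero {n : ℕ} {q : Polynomial ℝ} (hq : q.degree < n) :
    ∫ t in (-1 : ℝ)..1, (legendrePoly n * q).eval t = 0 := by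
  have := integral_iterate_derivative_mul_eq_zero n le_rfl q hq
  simp only [legendrePoly, Polynomial.eval_mul, Polynomial.eval_C, mul_assoc] at this ⊢
  rw [intervalIntegral.integral_const_mul, this, mul_zero]

-- Rolle's theorem, with multiplicities: each derivative loses at most one real root. Applied to the
-- `2 * n` roots of `(X ^ 2 - 1) ^ n`, this leaves `n` for the Legendre polynomial.
open Polynomial in
theorem card_roots_iterate_derivative (p : Polynomial ℝ) (k : ℕ) :
    p.roots.card ≤ (derivative^[k] p).roots.card + k := by
  induction k with
  | zero => simp
  | succ k ih =>
    rw [Function.iterate_succ_apply']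
    have := Polynomial.card_roots_le_derivative (derivative^[k] p)
    omega

open Polynomial in
theorem card_roots_X_sq_sub_one_pow (n : ℕ) :
    ((X ^ 2 - 1 : Polynomial ℝ) ^ n).roots.card = 2 * n := by
  have : (X ^ 2 - 1 : Polynomial ℝ) = (X - C 1) * (X - C (-1)) := by
    simp only [map_neg, map_one]; ring
  rw [roots_pow, this, roots_mul (mul_ne_zero (X_sub_C_ne_zero _) (X_sub_C_ne_zero _)),
    roots_X_sub_C, roots_X_sub_C]
  simp; ring

theorem natDegree_legendrePoly_le (n : ℕ) : (legendrePoly n).natDegree ≤ n := by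
  refine (Polynomial.natDegree_C_mul_le _ _).trans
    ((Polynomial.natDegree_iterate_derivative _ _).trans ?_)
  have h1 : ((Polynomial.X ^ 2 - 1 : Polynomial ℝ)).natDegree ≤ 2 := by compute_degree
  have : ((Polynomial.X ^ 2 - 1 : Polynomial ℝ) ^ n).natDegree ≤ n * 2 :=
    Polynomial.natDegree_pow_le_of_le n h1
  omega

theorem card_roots_legendrePoly (n : ℕ) : (legendrePoly n).roots.card = n := by
  refine le_antisymm ((Polynomial.card_roots' _).trans (natDegree_legendrePoly_le n)) ?_
  have h1 := card_roots_iterate_derivative ((Polynomial.X ^ 2 - 1 : Polynomial ℝ) ^ n) n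
  rw [card_roots_X_sq_sub_one_pow] at h1
  rw [legendrePoly, Polynomial.roots_C_mul _ (by positivity)]
  omega

theorem legendrePoly_ne_zero (n : ℕ) : legendrePoly n ≠ 0 := by
  rcases eq_or_ne n 0 with rfl | hn
  · simp [legendrePoly]
  · intro h
    have := card_roots_legendrePoly n
    simp [h] at this
    omega

/-- A polynomial which is nonnegative on `(-1, 1)` and has integral zero vanishes. -/
theorem Polynomial.eq_zero_of_integral_eq_zero {p : Polynomial ℝ}
    (hp : ∀ t ∈ Ioo (-1 : ℝ) 1, 0 ≤ p.eval t) (h : ∫ t in (-1 : ℝ)..1, p.eval t = 0) : p = 0 := by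
  have hcl : ∀ t ∈ Icc (-1 : ℝ) 1, 0 ≤ p.eval t := by
    have : closure (Ioo (-1 : ℝ) 1) ⊆ {t | 0 ≤ p.eval t} :=
      closure_minimal hp (isClosed_le continuous_const p.continuous)
    rwa [closure_Ioo (by norm_num)] at this
  by_contra h0
  have hpos : ∃ c ∈ Icc (-1 : ℝ) 1, 0 < p.eval c := by
    by_contra! hc
    refine h0 (Polynomial.eq_zero_of_infinite_isRoot p ?_)
    refine (Icc_infinite (show (-1 : ℝ) < 1 by norm_num)).mono fun t ht => ?_
    exact le_antisymm (hc t ht) (hcl t ht)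
  have := intervalIntegral.integral_pos (a := -1) (b := 1) (by norm_num) p.continuous.continuousOn
    (fun t ht => hcl t (Ioc_subset_Icc_self ht)) hpos
  linarith

theorem degree_lt_of_legendrePoly_eq_mul {n : ℕ} {a q : Polynomial ℝ} (ha : 0 < a.natDegree)
    (h : legendrePoly n = a * q) : q.degree < n := by
  have h0 : a * q ≠ 0 := h ▸ legendrePoly_ne_zero n
  have h1 := natDegree_legendrePoly_le n
  rw [h, Polynomial.natDegree_mul (left_ne_zero_of_mul h0) (right_ne_zero_of_mul h0)] at h1
  rw [Polynomial.degree_eq_natDegree (right_ne_zero_of_mul h0)]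
  exact_mod_cast (by omega : q.natDegree < n)

/-- If `P_n = (X - a) ^ 2 * q`, then `P_n * q` is a square whose integral vanishes by orthogonality.
-/
theorem nodup_roots_legendrePoly (n : ℕ) : (legendrePoly n).roots.Nodup := by
  refine Multiset.nodup_iff_count_le_one.2 fun a => ?_
  by_contra! hc
  rw [Polynomial.count_roots] at hc
  obtain ⟨q, hq⟩ : (Polynomial.X - Polynomial.C a) ^ 2 ∣ legendrePoly n :=
    (pow_dvd_pow _ hc).trans (Polynomial.pow_rootMultiplicity_dvd _ _)
  have hdeg := degree_lt_of_legendrePoly_eq_mul (by simp) hq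
  have h1 := integral_legendrePoly_mul_eq_zero hdeg
  have h2 := Polynomial.eq_zero_of_integral_eq_zero (fun t _ => ?_) h1
  · refine mul_ne_zero (legendrePoly_ne_zero n) ?_ h2
    rintro rfl
    exact legendrePoly_ne_zero n (by simpa using hq)
  · rw [hq]
    simp only [Polynomial.eval_mul, Polynomial.eval_pow]
    nlinarith [sq_nonneg ((Polynomial.X - Polynomial.C a).eval t * q.eval t)]

/-- If `P_n = (X - a) * q` with `a` outside `(-1, 1)`, then `P_n * q = (X - a) * q ^ 2` has constant
sign there, against orthogonality. -/
theorem mem_Ioo_of_mem_roots_legendrePoly {n : ℕ} {a : ℝ} (ha : a ∈ (legendrePoly n).roots) :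
    a ∈ Ioo (-1 : ℝ) 1 := by
  obtain ⟨q, hq⟩ := Polynomial.dvd_iff_isRoot.2 (Polynomial.isRoot_of_mem_roots ha)
  have hdeg := degree_lt_of_legendrePoly_eq_mul (by simp) hq
  have hq0 : q ≠ 0 := by
    rintro rfl
    exact legendrePoly_ne_zero n (by simpa using hq)
  have h1 := integral_legendrePoly_mul_eq_zero hdeg
  have he : ∀ t, (legendrePoly n * q).eval t = (t - a) * (q.eval t * q.eval t) := fun t => by
    rw [hq]; simp [mul_assoc]
  by_contra hc
  rcases le_or_gt a (-1) with h | h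
  · refine mul_ne_zero (legendrePoly_ne_zero n) hq0
      (Polynomial.eq_zero_of_integral_eq_zero (fun t ht => ?_) h1)
    rw [he]
    exact mul_nonneg (by linarith [ht.1]) (mul_self_nonneg _)
  · have h' : 1 ≤ a := by
      by_contra! h3
      exact hc ⟨h, h3⟩
    refine neg_ne_zero.2 (mul_ne_zero (legendrePoly_ne_zero n) hq0)
      (Polynomial.eq_zero_of_integral_eq_zero (fun t ht => ?_) ?_)
    · rw [Polynomial.eval_neg, he]
      nlinarith [mul_nonneg (show 0 ≤ a - t by linarith [ht.2]) (mul_self_nonneg (q.eval t))]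
    · simp only [Polynomial.eval_neg, intervalIntegral.integral_neg, h1, neg_zero]

theorem card_gaussLegendreNodes (n : ℕ) : (gaussLegendreNodes n).card = n := by
  rw [gaussLegendreNodes, Multiset.toFinset_card_of_nodup (nodup_roots_legendrePoly n),
    card_roots_legendrePoly]

theorem gaussLegendreNodes_subset (n : ℕ) {x : ℝ} (hx : x ∈ gaussLegendreNodes n) :
    x ∈ Icc (-1 : ℝ) 1 :=
  Ioo_subset_Icc_self (mem_Ioo_of_mem_roots_legendrePoly (by simpa [gaussLegendreNodes] using hx))

/-! ### Interpolatory weights and positivity for Gauss–Legendre -/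

/-- An interpolatory rule integrates polynomials of small degree exactly. -/
theorem sum_interpolatoryWeight_mul_eval {s : Finset ℝ} {p : Polynomial ℝ}
    (hp : p.degree < s.card) :
    ∑ x ∈ s, interpolatoryWeight s x * p.eval x = ∫ t in (-1 : ℝ)..1, p.eval t := by
  have h := Lagrange.eq_interpolate (s := s) (v := id) (Function.injective_id.injOn) hp
  have : ∀ t, p.eval t = ∑ x ∈ s, p.eval x * (Lagrange.basis s id x).eval t := fun t => by
    conv_lhs => rw [h]
    simp [Lagrange.interpolate_apply, Polynomial.eval_finsetSum]
  rw [intervalIntegral.integral_congr fun t _ => this t, intervalIntegral.integral_finsetSum]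
  · refine Finset.sum_congr rfl fun x hx => ?_
    rw [intervalIntegral.integral_const_mul, interpolatoryWeight, mul_comm]
  · intro x _
    exact ((Lagrange.basis s id x).continuous.const_mul _).intervalIntegrable _ _

theorem sum_interpolatoryWeight {s : Finset ℝ} (hs : s.Nonempty) :
    ∑ x ∈ s, interpolatoryWeight s x = 2 := by
  have := sum_interpolatoryWeight_mul_eval (s := s) (p := 1)
    (by rw [Polynomial.degree_one]; exact_mod_cast hs.card_pos)
  simp at this
  rw [this]; norm_num

/-- For a basis polynomial `l`, `l * l - l` vanishes at all nodes, so it is `P_n * q` with `q` of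
degree less than `n`. By orthogonality the weight equals the integral of `l * l`. -/
theorem interpolatoryWeight_gaussLegendre_nonneg {n : ℕ} {x : ℝ} (hx : x ∈ gaussLegendreNodes n) :
    0 ≤ interpolatoryWeight (gaussLegendreNodes n) x := by
  set s := gaussLegendreNodes n with hs
  set l := Lagrange.basis s id x with hl
  have hinj : Set.InjOn (id : ℝ → ℝ) s := Function.injective_id.injOn
  have hdvd : legendrePoly n ∣ l * l - l := by
    have hsplit : (legendrePoly n).roots.card = (legendrePoly n).natDegree :=
      le_antisymm (Polynomial.card_roots' _)
        ((natDegree_legendrePoly_le n).trans (card_roots_legendrePoly n).ge)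
    have := Polynomial.C_leadingCoeff_mul_prod_multiset_X_sub_C hsplit
    rw [← this, (Polynomial.isUnit_C.2 (Polynomial.leadingCoeff_ne_zero.2
      (legendrePoly_ne_zero n)).isUnit).mul_left_dvd]
    rcases eq_or_ne (l * l - l) 0 with h0 | h0
    · rw [h0]; exact dvd_zero _
    rw [Multiset.prod_X_sub_C_dvd_iff_le_roots h0,
      Multiset.le_iff_subset (nodup_roots_legendrePoly n)]
    intro y hy
    have hy' : y ∈ s := by simpa [hs, gaussLegendreNodes] using hy
    rw [Polynomial.mem_roots h0, Polynomial.IsRoot.def]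
    rcases eq_or_ne x y with rfl | hxy
    · have := Lagrange.eval_basis_self hinj hx
      simp only [id] at this
      simp [hl, this]
    · have := Lagrange.eval_basis_of_ne (v := (id : ℝ → ℝ)) hxy hy'
      simp only [id] at this
      simp [hl, this]
  obtain ⟨q, hq⟩ := hdvd
  have hn : 0 < n := by
    rw [← card_gaussLegendreNodes n]
    exact Finset.card_pos.2 ⟨x, hx⟩
  have hdeg : q.degree < n := by
    rcases eq_or_ne q 0 with rfl | hq0
    · simp
    have h1 : (l * l - l).natDegree ≤ (n - 1) + (n - 1) := by
      have h2 : l.natDegree = n - 1 := by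
        rw [hl, Lagrange.natDegree_basis hinj hx, hs, card_gaussLegendreNodes]
      refine (Polynomial.natDegree_sub_le _ _).trans (max_le ?_ (by omega))
      exact Polynomial.natDegree_mul_le.trans (by omega)
    have h3 : n ≤ (legendrePoly n).natDegree :=
      (card_roots_legendrePoly n).symm.le.trans (Polynomial.card_roots' _)
    rw [hq, Polynomial.natDegree_mul (legendrePoly_ne_zero n) hq0] at h1
    rw [Polynomial.degree_eq_natDegree hq0]
    exact_mod_cast (by omega : q.natDegree < n)
  have h := integral_legendrePoly_mul_eq_zero hdeg
  rw [← hq] at h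
  simp only [Polynomial.eval_sub] at h
  rw [intervalIntegral.integral_sub ((l * l).continuous.intervalIntegrable _ _)
    (l.continuous.intervalIntegrable _ _)] at h
  rw [interpolatoryWeight, ← hl, ← sub_eq_zero.1 h]
  refine intervalIntegral.integral_nonneg (by norm_num) fun t _ => ?_
  rw [Polynomial.eval_mul]
  exact mul_self_nonneg _

theorem sum_abs_interpolatoryWeight_gaussLegendre {n : ℕ} (hn : 0 < n) :
    ∑ x ∈ gaussLegendreNodes n, |interpolatoryWeight (gaussLegendreNodes n) x| = 2 := by
  rw [← sum_interpolatoryWeight (s := gaussLegendreNodes n)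
    (Finset.card_pos.1 ((card_gaussLegendreNodes n).symm ▸ hn))]
  exact Finset.sum_congr rfl fun x hx =>
    abs_of_nonneg (interpolatoryWeight_gaussLegendre_nonneg hx)

/-! ### Clenshaw–Curtis nodes and weights -/

-- The differentiated polynomial is the node polynomial for `N + 1` points. This form of its
-- derivative yields both the lower bound `N` at the nodes and the upper bound `2 * N` on `[-1, 1]`.
open Polynomial Polynomial.Chebyshev in
theorem derivative_one_sub_X_sq_mul_U (N : ℤ) :
    derivative ((1 - X ^ 2) * U ℝ (N - 1)) = -(X * U ℝ (N - 1)) - (N : ℝ[X]) * T ℝ N := by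
  have h1 : (1 - X ^ 2) * U ℝ (N - 1) = T ℝ (N - 1) * 1 - X * T ℝ N := by
    have := T_eq_X_mul_T_sub_pol_U ℝ (N - 1)
    have h2 := T_sub_one ℝ N
    rw [show N - 1 + 2 = N + 1 by ring, show N - 1 + 1 = N by ring] at this
    linear_combination this - h2
  have h3 := T_eq_X_mul_U_sub_U ℝ (N - 2)
  rw [show N - 2 + 2 = N by ring, show N - 2 + 1 = N - 1 by ring] at h3
  rw [h1, mul_one, derivative_sub, derivative_mul, T_derivative_eq_U, T_derivative_eq_U,
    derivative_X, show N - 1 - 1 = N - 2 by ring]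
  push_cast
  linear_combination ((N : ℝ[X]) - 1) * h3

-- The derivative of `T_N` is `N * U_(N-1)` and is largest in absolute value at `1`.
open Polynomial Polynomial.Chebyshev in
theorem abs_eval_U_le {N : ℕ} (hN : 0 < N) {t : ℝ} (ht : |t| ≤ 1) :
    |(U ℝ ((N : ℤ) - 1)).eval t| ≤ N := by
  have h := abs_iterate_derivative_T_real_le N 1 ht
  simp only [Function.iterate_one, T_derivative_eq_U, eval_mul, U_eval_one, eval_intCast] at h
  have hN' : (0 : ℝ) < N := by exact_mod_cast hN
  rw [abs_mul] at h
  push_cast at h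
  rw [abs_of_pos hN', sub_add_cancel] at h
  exact le_of_mul_le_mul_left h hN'

theorem card_clenshawCurtisNodes (n : ℕ) (hn : 2 ≤ n) :
    (clenshawCurtisNodes n).card = n := by
  rw [clenshawCurtisNodes, Finset.card_image_of_injOn, Finset.card_range]
  have hn' : (0 : ℝ) < (n : ℝ) - 1 := by
    have : (2 : ℝ) ≤ n := by exact_mod_cast hn
    linarith
  have hmem : ∀ k ∈ Finset.range n, (k : ℝ) * Real.pi / ((n : ℝ) - 1) ∈ Icc 0 Real.pi := by
    intro k hk
    refine ⟨by positivity, ?_⟩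
    rw [div_le_iff₀ hn', mul_comm]
    refine mul_le_mul_of_nonneg_left ?_ Real.pi_pos.le
    have : (k : ℝ) + 1 ≤ n := by exact_mod_cast Finset.mem_range.1 hk
    linarith
  intro i hi j hj hij
  have := Real.injOn_cos (hmem i hi) (hmem j hj) hij
  rw [div_left_inj' hn'.ne', mul_left_inj' Real.pi_ne_zero] at this
  exact_mod_cast this

theorem clenshawCurtisNodes_subset (n : ℕ) {x : ℝ} (hx : x ∈ clenshawCurtisNodes n) :
    x ∈ Icc (-1 : ℝ) 1 := by
  obtain ⟨k, _, rfl⟩ := Finset.mem_image.1 hx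
  exact ⟨Real.neg_one_le_cos _, Real.cos_le_one _⟩

open Polynomial Polynomial.Chebyshev in
theorem clenshawCurtisNodes_eval {N : ℕ} (hN : 0 < N) {x : ℝ}
    (hx : x ∈ clenshawCurtisNodes (N + 1)) :
    ((1 - X ^ 2) * U ℝ ((N : ℤ) - 1)).eval x = 0 ∧ |(T ℝ N).eval x| = 1 := by
  obtain ⟨k, hk, rfl⟩ := Finset.mem_image.1 hx
  have hN' : (N : ℝ) ≠ 0 := by exact_mod_cast hN.ne'
  push_cast
  rw [add_sub_cancel_right]
  set θ := (k : ℝ) * Real.pi / N with hθ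
  have hNθ : (N : ℝ) * θ = k * Real.pi := by rw [hθ]; field_simp
  constructor
  · have h := U_real_cos θ ((N : ℤ) - 1)
    push_cast at h
    rw [sub_add_cancel, hNθ, Real.sin_nat_mul_pi] at h
    simp only [eval_mul, eval_sub, eval_one, eval_pow, eval_X, ← Real.sin_sq]
    linear_combination Real.sin θ * h
  · have h := T_real_cos θ (N : ℤ)
    push_cast at h
    rw [h, hNθ]
    exact Real.abs_cos_int_mul_pi k

-- At interior nodes the `U` term vanishes and `|T_N| = 1`, giving exactly `N`; at `± 1` the two
-- terms add up to `2 * N` in absolute value.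
open Polynomial Polynomial.Chebyshev in
theorem le_abs_derivative_eval_node {N : ℕ} (hN : 0 < N) {x : ℝ}
    (hx : x ∈ clenshawCurtisNodes (N + 1)) :
    (N : ℝ) ≤ |(derivative ((1 - X ^ 2) * U ℝ ((N : ℤ) - 1))).eval x| := by
  obtain ⟨h1, h2⟩ := clenshawCurtisNodes_eval hN hx
  have hN' : (0 : ℝ) < N := by exact_mod_cast hN
  rw [derivative_one_sub_X_sq_mul_U]
  simp only [eval_sub, eval_neg, eval_mul, eval_X, eval_intCast]
  push_cast
  simp only [eval_mul, eval_sub, eval_one, eval_pow, eval_X, mul_eq_zero] at h1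
  rcases h1 with h1 | h1
  · have hodd : ((N : ℤ) - 1).negOnePow = -(N : ℤ).negOnePow := by
      rw [Int.negOnePow_sub, Int.negOnePow_one]; simp
    have : x = 1 ∨ x = -1 := by
      exact eq_or_eq_neg_of_sq_eq_sq x 1 (by linarith)
    rcases this with rfl | rfl
    · rw [U_eval_one, T_eval_one]
      push_cast
      rw [abs_of_neg] <;> linarith
    · rw [U_eval_neg_one, T_eval_neg_one] at *
      rw [hodd]
      push_cast
      rw [show -(-1 * (-(((N : ℤ).negOnePow : ℤ) : ℝ) * ((N : ℝ) - 1 + 1))) -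
        N * (((N : ℤ).negOnePow : ℤ) : ℝ) = -(2 * N) * (((N : ℤ).negOnePow : ℤ) : ℝ) by ring,
        abs_mul, h2, mul_one, abs_neg, abs_of_pos (by positivity)]
      linarith
  · rw [h1, mul_zero, neg_zero, zero_sub, abs_neg, abs_mul, h2, mul_one, abs_of_pos hN']

-- With node polynomial `ψ`, the basis polynomial is `ψ / ((X - x) * ψ'(x))`. The mean value
-- inequality gives `|ψ(t)| ≤ 2 * N * |t - x|`, and `|ψ'(x)| ≥ N`.
open Polynomial Polynomial.Chebyshev in
theorem abs_eval_basis_clenshawCurtisNodes_le {N : ℕ} (hN : 0 < N) {x : ℝ}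
    (hx : x ∈ clenshawCurtisNodes (N + 1)) {t : ℝ} (ht : t ∈ Icc (-1 : ℝ) 1) :
    |(Lagrange.basis (clenshawCurtisNodes (N + 1)) id x).eval t| ≤ 2 := by
  set s := clenshawCurtisNodes (N + 1) with hs
  set ψ : ℝ[X] := (1 - X ^ 2) * U ℝ ((N : ℤ) - 1) with hψ
  have hN' : (0 : ℝ) < N := by exact_mod_cast hN
  have hinj : Set.InjOn (id : ℝ → ℝ) s := Function.injective_id.injOn
  have hcard : s.card = N + 1 := card_clenshawCurtisNodes _ (by omega)
  have hlow := le_abs_derivative_eval_node hN hx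
  rw [← hψ] at hlow
  obtain ⟨q, hq⟩ := dvd_iff_isRoot.2 (show ψ.IsRoot x from (clenshawCurtisNodes_eval hN hx).1)
  have hψ0 : ψ ≠ 0 := by
    intro h
    rw [h] at hlow
    simp at hlow
    omega
  have hdq : q.degree < s.card := by
    have hq0 : q ≠ 0 := by
      rintro rfl
      exact hψ0 (by simpa using hq)
    have h1 : ψ.natDegree ≤ N + 1 := by
      refine natDegree_mul_le.trans ?_
      have h2 : (1 - X ^ 2 : ℝ[X]).natDegree ≤ 2 := by compute_degree
      have h3 : (U ℝ ((N : ℤ) - 1)).natDegree = N - 1 := by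
        rw [show (N : ℤ) - 1 = ((N - 1 : ℕ) : ℤ) by omega, natDegree_U_natCast]
      omega
    rw [hq, natDegree_mul (X_sub_C_ne_zero x) hq0, natDegree_X_sub_C] at h1
    rw [degree_eq_natDegree hq0, hcard]
    exact_mod_cast (by omega : q.natDegree < N + 1)
  have hqx : q.eval x = (derivative ψ).eval x := by
    rw [hq]; simp [derivative_mul]
  have hql : q = C ((derivative ψ).eval x) * Lagrange.basis s id x := by
    refine Polynomial.eq_of_degrees_lt_of_eval_finset_eq s hdq ?_ fun y hy => ?_
    · refine (degree_mul_le _ _).trans_lt ((add_le_add degree_C_le le_rfl).trans_lt ?_)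
      rw [Lagrange.degree_basis hinj hx, hcard, zero_add]
      exact_mod_cast (by omega : N + 1 - 1 < N + 1)
    · rcases eq_or_ne x y with rfl | hxy
      · have := Lagrange.eval_basis_self hinj hx
        simp only [id] at this
        rw [hqx, eval_mul, eval_C, this, mul_one]
      · have := Lagrange.eval_basis_of_ne (v := (id : ℝ → ℝ)) hxy hy
        simp only [id] at this
        rw [eval_mul, this, mul_zero]
        have h0 := (clenshawCurtisNodes_eval hN hy).1
        rw [← hψ, hq, eval_mul, mul_eq_zero] at h0
        refine h0.resolve_left ?_
        simpa [sub_eq_zero] using hxy.symm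
  have hx' := clenshawCurtisNodes_subset _ hx
  rcases eq_or_ne t x with rfl | htx
  · have := Lagrange.eval_basis_self hinj hx
    simp only [id] at this
    rw [this]; norm_num
  have hup : ∀ y ∈ Icc (-1 : ℝ) 1, ‖deriv (fun z => ψ.eval z) y‖ ≤ 2 * N := by
    intro y hy
    have hy1 : |y| ≤ 1 := abs_le.2 hy
    rw [Polynomial.deriv, hψ, derivative_one_sub_X_sq_mul_U, Real.norm_eq_abs]
    simp only [eval_sub, eval_neg, eval_mul, eval_X, eval_intCast]
    refine (abs_sub _ _).trans ?_
    rw [abs_neg, abs_mul, abs_mul]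
    have h1 := abs_eval_U_le hN hy1
    have h2 := abs_eval_T_real_le_one N hy1
    have h3 : |y| * |(U ℝ ((N : ℤ) - 1)).eval y| ≤ 1 * N :=
      mul_le_mul hy1 h1 (abs_nonneg _) zero_le_one
    have h4 : |((N : ℤ) : ℝ)| * |(T ℝ (N : ℤ)).eval y| ≤ N * 1 := by
      push_cast
      rw [abs_of_pos hN']
      exact mul_le_mul_of_nonneg_left h2 hN'.le
    linarith
  have hmvt := (convex_Icc (-1 : ℝ) 1).norm_image_sub_le_of_norm_deriv_le
    (fun y _ => ψ.differentiable.differentiableAt) hup hx' ht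
  have hψx : ψ.eval x = 0 := (clenshawCurtisNodes_eval hN hx).1
  rw [hψx, sub_zero, hq, eval_mul, hql, eval_mul, eval_C] at hmvt
  simp only [eval_sub, eval_X, eval_C, Real.norm_eq_abs, abs_mul] at hmvt
  have htx' : 0 < |t - x| := abs_pos.2 (sub_ne_zero.2 htx)
  have h5 : |(derivative ψ).eval x| * |(Lagrange.basis s id x).eval t| ≤ 2 * N := by
    refine le_of_mul_le_mul_left ?_ htx'
    linarith
  have h6 : (N : ℝ) * |(Lagrange.basis s id x).eval t| ≤ N * 2 := by
    refine (mul_le_mul_of_nonneg_right hlow (abs_nonneg _)).trans ?_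
    linarith
  exact le_of_mul_le_mul_left h6 hN'

/-- Each weight is at most `2 * 2`. Linear growth is harmless against the exponential error, so
positivity of the weights is not needed. -/
theorem sum_abs_interpolatoryWeight_clenshawCurtis_le {n : ℕ} (hn : 2 ≤ n) :
    ∑ x ∈ clenshawCurtisNodes n, |interpolatoryWeight (clenshawCurtisNodes n) x| ≤ 4 * n := by
  obtain ⟨N, rfl⟩ : ∃ N, n = N + 1 := ⟨n - 1, by omega⟩
  have : ∀ x ∈ clenshawCurtisNodes (N + 1),
      |interpolatoryWeight (clenshawCurtisNodes (N + 1)) x| ≤ 4 := by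
    intro x hx
    have := intervalIntegral.norm_integral_le_of_norm_le_const (a := (-1 : ℝ)) (b := 1) (C := 2)
      (f := fun t => (Lagrange.basis (clenshawCurtisNodes (N + 1)) id x).eval t) fun t ht => by
        rw [uIoc_of_le (by norm_num)] at ht
        exact abs_eval_basis_clenshawCurtisNodes_le (by omega) hx (Ioc_subset_Icc_self ht)
    rw [Real.norm_eq_abs] at this
    refine this.trans ?_
    norm_num
  refine (Finset.sum_le_card_nsmul _ _ _ this).trans ?_
  rw [card_clenshawCurtisNodes _ hn, nsmul_eq_mul, mul_comm]

/-! ### Fourier and Chebyshev expansions of analytic functions -/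

/-- Cauchy's theorem on a rectangle; by periodicity the vertical sides cancel. -/
theorem integral_eq_integral_add_mul_I {H : ℂ → ℂ} {η s : ℝ} (hs : |s| ≤ η)
    (hd : ∀ z : ℂ, |z.im| ≤ η → DifferentiableAt ℂ H z)
    (hp : ∀ z, H (z + 2 * Real.pi) = H z) :
    ∫ x in (0 : ℝ)..2 * Real.pi, H x = ∫ x in (0 : ℝ)..2 * Real.pi, H (x + s * Complex.I) := by
  have h := Complex.integral_boundary_rect_eq_zero_of_differentiableOn H 0
    (2 * Real.pi + s * Complex.I) fun z hz => by
      refine (hd z ?_).differentiableWithinAt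
      have h1 := hz.2
      simp only [Complex.zero_im, mem_preimage, Complex.add_im, Complex.mul_im, Complex.I_im,
        Complex.I_re, Complex.ofReal_re, Complex.ofReal_im, Complex.re_ofNat, Complex.im_ofNat,
        mul_zero, zero_mul, add_zero, zero_add, mul_one] at h1
      have h2 := abs_sub_left_of_mem_uIcc h1
      simp only [sub_zero] at h2
      exact h2.trans hs
  have hre : (2 * (Real.pi : ℂ) + s * Complex.I).re = 2 * Real.pi := by simp
  have him : (2 * (Real.pi : ℂ) + s * Complex.I).im = s := by simp
  rw [hre, him] at h
  have hper : ∀ y : ℝ, H (((2 * Real.pi : ℝ) : ℂ) + y * Complex.I) = H (y * Complex.I) := by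
    intro y
    rw [← hp (y * Complex.I)]
    push_cast
    rw [add_comm]
  simp only [hper, Complex.zero_re, Complex.zero_im, Complex.ofReal_zero, zero_mul, add_zero,
    zero_add] at h
  rw [add_sub_cancel_right, sub_eq_zero] at h
  exact h

/-- Fourier expansion of a periodic function analytic in a strip. -/
theorem exists_hasSum_exp_of_differentiableAt_strip {G : ℂ → ℂ} {η M : ℝ} (hη : 0 < η)
    (hd : ∀ z : ℂ, |z.im| ≤ η → DifferentiableAt ℂ G z)
    (hM : ∀ z : ℂ, |z.im| ≤ η → ‖G z‖ ≤ M)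
    (hp : ∀ z, G (z + 2 * Real.pi) = G z) :
    ∃ c : ℤ → ℂ, (∀ k, ‖c k‖ ≤ M * Real.exp (-η) ^ k.natAbs) ∧
      ∀ x : ℝ, HasSum (fun k : ℤ => c k * Complex.exp (k * x * Complex.I)) (G x) := by
  have : Fact (0 < 2 * Real.pi) := ⟨Real.two_pi_pos⟩
  have hM0 : 0 ≤ M := (norm_nonneg _).trans (hM 0 (by simpa using hη.le))
  have hper : Function.Periodic (fun x : ℝ => G x) (2 * Real.pi) := fun x => by
    simpa using hp x
  have hcont : Continuous (fun x : ℝ => G x) := by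
    rw [continuous_iff_continuousAt]
    intro x
    exact ContinuousAt.comp (f := fun x : ℝ => (x : ℂ))
      (hd x (by simpa using hη.le)).continuousAt Complex.continuous_ofReal.continuousAt
  let g : C(AddCircle (2 * Real.pi), ℂ) :=
    ⟨hper.lift, continuous_coinduced_dom.2 (by exact hcont)⟩
  have hg : ∀ x : ℝ, g (x : AddCircle (2 * Real.pi)) = G x := fun x => hper.lift_coe x
  have hexp : ∀ (k : ℤ) (x : ℝ), fourier k (x : AddCircle (2 * Real.pi)) =
      Complex.exp (k * x * Complex.I) := by
    intro k x
    rw [fourier_coe_apply]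
    congr 1
    have : (Real.pi : ℂ) ≠ 0 := by exact_mod_cast Real.pi_ne_zero
    push_cast
    field_simp
  have hcoeff : ∀ (k : ℤ) (s : ℝ), |s| ≤ η → fourierCoeff g k = (1 / (2 * Real.pi)) •
      ∫ x in (0 : ℝ)..2 * Real.pi, Complex.exp (-(k * (x + s * Complex.I) * Complex.I)) *
        G (x + s * Complex.I) := by
    intro k s hs
    rw [fourierCoeff_eq_intervalIntegral _ _ 0, zero_add]
    simp only [hg, hexp, smul_eq_mul]
    congr 1
    rw [← integral_eq_integral_add_mul_I (η := η)
      (H := fun z => Complex.exp (-(k * z * Complex.I)) * G z) hs]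
    · push_cast
      simp only [neg_mul]
    · intro z hz
      exact (by fun_prop : DifferentiableAt ℂ (fun z => Complex.exp (-(k * z * Complex.I))) z).mul
        (hd z hz)
    · intro z
      rw [hp]
      congr 1
      rw [Complex.exp_eq_exp_iff_exists_int]
      exact ⟨-k, by push_cast; ring⟩
  have hbound : ∀ k, ‖fourierCoeff g k‖ ≤ M * Real.exp (-η) ^ k.natAbs := by
    intro k
    -- The contour moves to the side on which `|exp (-i k z)| = exp (k * s)` is `exp (-η * |k|)`.
    obtain ⟨s, hs, hks⟩ : ∃ s : ℝ, |s| ≤ η ∧ (k : ℝ) * s = -η * k.natAbs := by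
      rcases le_total 0 k with hk | hk
      · refine ⟨-η, by rw [abs_neg, abs_of_pos hη], ?_⟩
        rw [Nat.cast_natAbs, abs_of_nonneg hk]; ring
      · refine ⟨η, by rw [abs_of_pos hη], ?_⟩
        rw [Nat.cast_natAbs, abs_of_nonpos hk]; push_cast; ring
    rw [hcoeff k s hs, norm_smul]
    have := intervalIntegral.norm_integral_le_of_norm_le_const (a := (0 : ℝ)) (b := 2 * Real.pi)
      (C := M * Real.exp (-η) ^ k.natAbs)
      (f := fun x : ℝ => Complex.exp (-(k * (x + s * Complex.I) * Complex.I)) *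
        G (x + s * Complex.I)) fun x _ => by
      rw [norm_mul, mul_comm M, Complex.norm_exp]
      refine mul_le_mul (le_of_eq ?_) (hM _ (by simpa using hs)) (norm_nonneg _) (by positivity)
      rw [← Real.exp_nat_mul]
      congr 1
      rw [mul_comm (k.natAbs : ℝ), ← hks]
      simp
    refine (mul_le_mul_of_nonneg_left this (norm_nonneg _)).trans (le_of_eq ?_)
    have hpi := Real.pi_pos
    rw [sub_zero, abs_of_pos Real.two_pi_pos, Real.norm_eq_abs, abs_of_pos (by positivity)]
    field_simp
  refine ⟨fourierCoeff g, hbound, fun x => ?_⟩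
  have hr : Real.exp (-η) < 1 := Real.exp_lt_one_iff.2 (by linarith)
  have hsum : Summable (fourierCoeff g) := by
    refine Summable.of_norm_bounded (g := fun k : ℤ => M * Real.exp (-η) ^ k.natAbs) ?_ hbound
    refine Summable.mul_left M (Summable.of_nat_of_neg ?_ ?_) <;>
    · simpa using summable_geometric_of_lt_one (Real.exp_pos _).le hr
  have := has_pointwise_sum_fourier_series_of_summable hsum (x : AddCircle (2 * Real.pi))
  simpa only [hg, hexp, smul_eq_mul] using this

open Polynomial.Chebyshev in
/-- Geometric convergence of Chebyshev expansions. -/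
theorem exists_chebyshev_approx {F : ℂ → ℂ} {η M : ℝ} (hη : 0 < η)
    (hd : ∀ z : ℂ, |z.im| ≤ η → DifferentiableAt ℂ F (Complex.cos z))
    (hM : ∀ z : ℂ, |z.im| ≤ η → ‖F (Complex.cos z)‖ ≤ M) :
    ∃ a : ℕ → ℂ, ∀ n : ℕ, 0 < n → ∀ x ∈ Icc (-1 : ℝ) 1,
      ‖F x - ∑ k ∈ Finset.range n, a k * ((T ℝ k).eval x : ℝ)‖ ≤
        2 * M * Real.exp (-η) ^ n / (1 - Real.exp (-η)) := by
  obtain ⟨c, hc, hsum⟩ := exists_hasSum_exp_of_differentiableAt_strip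
    (G := fun z => F (Complex.cos z)) hη (fun z hz => (hd z hz).comp z Complex.differentiable_cos.differentiableAt) hM
    (fun z => by rw [Complex.cos_add_two_pi])
  -- Folding `k` with `-k` counts the constant term twice, hence the correction at `0`.
  refine ⟨fun k => c k + c (-k) - if k = 0 then c 0 else 0, fun n hn x hx => ?_⟩
  set θ := Real.arccos x with hθ
  have hcos : Real.cos θ = x := Real.cos_arccos hx.1 hx.2
  have hT : ∀ k : ℕ, (((T ℝ k).eval x : ℝ) : ℂ) = Complex.cos (k * θ) := by
    intro k
    rw [← hcos, T_real_cos]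
    push_cast
    rfl
  -- Since cosine is even, averaging the expansions at `θ` and `-θ` turns exponentials into cosines.
  have h1 : HasSum (fun k : ℤ => c k * Complex.cos (k * θ)) (F x) := by
    have := ((hsum θ).add (hsum (-θ))).div_const 2
    simp only [Complex.ofReal_neg, Complex.cos_neg, ← Complex.ofReal_cos, hcos,
      add_self_div_two] at this
    refine this.congr_fun fun k => ?_
    rw [Complex.cos]
    ring_nf
  have h2 : HasSum (fun k : ℕ => (c k + c (-k)) * Complex.cos (k * θ)) (F x + c 0) := by
    have := h1.nat_add_neg
    simp only [Int.cast_zero, zero_mul, Complex.cos_zero, mul_one, Int.cast_neg, neg_mul,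
      Complex.cos_neg, Int.cast_natCast, ← add_mul] at this
    exact this
  have h3 := norm_sub_le_of_geometric_bound_of_hasSum (r := Real.exp (-η)) (C := 2 * M)
    (Real.exp_lt_one_iff.2 (by linarith)) (fun k => ?_) h2 n
  · rw [norm_sub_rev] at h3
    refine le_of_eq_of_le ?_ h3
    congr 1
    simp only [hT, sub_mul, Finset.sum_sub_distrib, ite_mul, zero_mul]
    rw [Finset.sum_ite_eq' (Finset.range n) 0, if_pos (Finset.mem_range.2 hn)]
    simp
    ring
  · rw [norm_mul]
    have h4 : ‖c k + c (-k)‖ ≤ 2 * M * Real.exp (-η) ^ k := by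
      refine (norm_add_le _ _).trans ?_
      have h5 := hc k
      have h6 := hc (-k)
      simp only [Int.natAbs_neg, Int.natAbs_natCast] at h5 h6
      linarith
    have h7 : ‖Complex.cos (k * θ)‖ ≤ 1 := by
      rw [← hT, Complex.norm_real]
      exact abs_eval_T_real_le_one k (abs_le.2 hx)
    calc _ ≤ ‖c k + c (-k)‖ * 1 := mul_le_mul_of_nonneg_left h7 (norm_nonneg _)
      _ ≤ _ := by rwa [mul_one]

/-! ### Boundedness of the weight on the half-width strip -/

theorem enorm_mul_two_pi_le_lintegral_circle {f : ℂ → ℂ} {z : ℂ} {r : ℝ} (hr : 0 < r)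
    (hf : DifferentiableOn ℂ f (Metric.closedBall z r)) :
    ENNReal.ofReal (2 * Real.pi) * ‖f z‖ₑ ≤
      ∫⁻ θ in Ioo (-Real.pi) Real.pi, ‖f (circleMap z r θ)‖ₑ := by
  have h1 : Real.circleAverage f z r = f z := by
    refine DiffContOnCl.circleAverage (DifferentiableOn.diffContOnCl ?_)
    rwa [abs_of_pos hr, closure_ball _ hr.ne']
  rw [Real.circleAverage_eq_integral_add (-Real.pi),
    intervalIntegral.integral_comp_add_right (fun θ => f (circleMap z r θ)),
    zero_add, show 2 * Real.pi + -Real.pi = Real.pi by ring,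
    intervalIntegral.integral_of_le (by linarith [Real.pi_pos]), integral_Ioc_eq_integral_Ioo] at h1
  have h2 : (∫ θ in Ioo (-Real.pi) Real.pi, f (circleMap z r θ)) = (2 * Real.pi : ℝ) • f z := by
    rw [← h1, smul_inv_smul₀ Real.two_pi_pos.ne']
  calc _ = ‖(2 * Real.pi : ℝ) • f z‖ₑ := by
        rw [enorm_smul, Real.enorm_of_nonneg Real.two_pi_pos.le]
    _ ≤ _ := by rw [← h2]; exact enorm_integral_le_lintegral_enorm _

/-- The mean value inequality on circles is integrated over the radii. Keeping only radii above `R /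
2` bounds the polar Jacobian below by `R / 2`. The function `g` allows `f` to be extended measurably
beyond the ball. -/
theorem enorm_mul_le_lintegral_ball {f : ℂ → ℂ} {z : ℂ} {R : ℝ} (hR : 0 < R)
    (hf : DifferentiableOn ℂ f (Metric.ball z R)) {g : ℂ → ℝ≥0∞} (hg : Measurable g)
    (hfg : ∀ w ∈ Metric.ball z R, g w = ‖f w‖ₑ) :
    ENNReal.ofReal (R / 2) * (ENNReal.ofReal (2 * Real.pi) * ‖f z‖ₑ) * ENNReal.ofReal (R / 2) ≤
      ∫⁻ w, g w := by
  rw [← lintegral_add_left_eq_self g z, ← Complex.lintegral_comp_polarCoord_symm]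
  have hsub : Ioo (R / 2) R ×ˢ Ioo (-Real.pi) Real.pi ⊆ polarCoord.target := by
    rw [polarCoord_target]
    exact prod_mono (fun r hr => (by linarith [hr.1] : 0 < r)) subset_rfl
  refine le_trans ?_ (lintegral_mono_set hsub)
  have hmap : ∀ p : ℝ × ℝ, z + Complex.polarCoord.symm p = circleMap z p.1 p.2 := fun p => by
    rw [Complex.polarCoord_symm_apply, circleMap, Complex.exp_mul_I]
    push_cast
    rfl
  have hmeas : Measurable fun p : ℝ × ℝ => ENNReal.ofReal p.1 • g (circleMap z p.1 p.2) := by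
    have : Continuous fun p : ℝ × ℝ => circleMap z p.1 p.2 := by
      unfold circleMap; fun_prop
    exact (ENNReal.measurable_ofReal.comp measurable_fst).mul (hg.comp this.measurable)
  simp only [hmap]
  rw [Measure.volume_eq_prod, ← Measure.prod_restrict, lintegral_prod _ hmeas.aemeasurable]
  calc _ = ∫⁻ r in Ioo (R / 2) R,
        ENNReal.ofReal (R / 2) * (ENNReal.ofReal (2 * Real.pi) * ‖f z‖ₑ) := by
        rw [setLIntegral_const, Real.volume_Ioo, sub_half]
    _ ≤ _ := by
      refine setLIntegral_mono' measurableSet_Ioo fun r hr => ?_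
      have hr0 : 0 < r := by linarith [hr.1]
      simp only [smul_eq_mul]
      rw [lintegral_const_mul' _ _ ENNReal.ofReal_ne_top]
      refine mul_le_mul' (ENNReal.ofReal_le_ofReal hr.1.le) ?_
      refine (enorm_mul_two_pi_le_lintegral_circle hr0
        (hf.mono (Metric.closedBall_subset_ball hr.2))).trans (le_of_eq ?_)
      refine setLIntegral_congr_fun measurableSet_Ioo fun θ _ => (hfg _ ?_).symm
      rw [Metric.mem_ball, dist_eq_norm, circleMap_sub_center, norm_circleMap_zero,
        abs_of_pos hr0]
      exact hr.2

theorem ball_subset_strip {d : ℝ} {z : ℂ} (hz : |z.im| ≤ d / 2) :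
    Metric.ball z (d / 2) ⊆ strip d := by
  intro w hw
  rw [Metric.mem_ball, dist_eq_norm] at hw
  have h1 := (Complex.abs_im_le_norm (w - z)).trans_lt hw
  rw [Complex.sub_im] at h1
  have h2 := abs_add_le (w.im - z.im) z.im
  rw [sub_add_cancel] at h2
  exact (by linarith : |w.im| < d)

/-- A function analytic in the strip is controlled by its integrals over vertical sections. -/
theorem enorm_mul_le_of_lintegral_vertical_le {d : ℝ} (hd : 0 < d) {f : ℂ → ℂ}
    (hf : AnalyticOnNhd ℂ f (strip d)) {z : ℂ} (hz : |z.im| ≤ d / 2)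
    (h : ∀ x ∈ Icc (z.re - d / 2) (z.re + d / 2),
      ∫⁻ y in Ioo (-d) d, ‖f ((x : ℂ) + (y : ℂ) * Complex.I)‖ₑ ≤ 1) :
    ENNReal.ofReal (d / 2 / 2) * (ENNReal.ofReal (2 * Real.pi) * ‖f z‖ₑ) *
      ENNReal.ofReal (d / 2 / 2) ≤ ENNReal.ofReal d := by
  classical
  have hsub := ball_subset_strip hz
  have hdiff : DifferentiableOn ℂ f (Metric.ball z (d / 2)) := hf.differentiableOn.mono hsub
  set g : ℂ → ℝ≥0∞ := (Metric.ball z (d / 2)).piecewise (fun w => ‖f w‖ₑ) (fun _ => 0) with hg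
  have hgm : Measurable g :=
    ContinuousOn.measurable_piecewise hdiff.continuousOn.enorm continuousOn_const
      Metric.isOpen_ball.measurableSet
  refine (enorm_mul_le_lintegral_ball (by positivity) hdiff hgm
    fun w hw => piecewise_eq_of_mem _ _ _ hw).trans ?_
  rw [← (Complex.volume_preserving_equiv_real_prod.symm).lintegral_comp_emb
    Complex.measurableEquivRealProd.symm.measurableEmbedding, Measure.volume_eq_prod,
    lintegral_prod _ (by fun_prop)]
  have hpt : ∀ x y : ℝ, Complex.measurableEquivRealProd.symm (x, y) = x + y * Complex.I :=
    fun x y => Complex.ext (by simp) (by simp)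
  simp only [hpt]
  calc _ ≤ ∫⁻ x, (Icc (z.re - d / 2) (z.re + d / 2)).indicator (fun _ => 1) x := by
        refine lintegral_mono fun x => ?_
        by_cases hx : x ∈ Icc (z.re - d / 2) (z.re + d / 2)
        · rw [indicator_of_mem hx]
          refine le_trans ?_ (h x hx)
          rw [← lintegral_indicator measurableSet_Ioo]
          refine lintegral_mono fun y => ?_
          by_cases hy : (x : ℂ) + y * Complex.I ∈ Metric.ball z (d / 2)
          · have hy' := hsub hy
            simp only [strip, mem_ofPred_eq, Complex.add_im, Complex.ofReal_im, Complex.mul_im,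
              Complex.ofReal_re, Complex.I_im, Complex.I_re, mul_one, mul_zero, add_zero,
              zero_add, abs_lt] at hy'
            rw [indicator_of_mem (by exact hy'), hg, piecewise_eq_of_mem _ _ _ hy]
          · rw [hg, piecewise_eq_of_notMem _ _ _ hy]
            exact bot_le
        · rw [indicator_of_notMem hx, nonpos_iff_eq_zero, lintegral_eq_zero_of_ae_eq_zero]
          refine Eventually.of_forall fun y => piecewise_eq_of_notMem _ _ _ fun hy => hx ?_
          rw [Metric.mem_ball, dist_eq_norm] at hy
          have h1 := (Complex.abs_re_le_norm _).trans hy.le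
          simp at h1
          rw [abs_le] at h1
          constructor <;> linarith [h1.1, h1.2]
    _ = _ := by
      rw [lintegral_indicator measurableSet_Icc, setLIntegral_one, Real.volume_Icc]
      congr 1
      ring

/-- Far out the vertical integrals are at most `1` and control point values; what remains is a
compact rectangle. -/
theorem IsClassB.exists_norm_le {d : ℝ} (hd : 0 < d) {ω : ℂ → ℂ} (hω : IsClassB d ω) :
    ∃ M : ℝ, ∀ z : ℂ, |z.im| ≤ d / 2 → ‖ω z‖ ≤ M := by
  obtain ⟨X₁, hX₁⟩ := eventually_atTop.1
    (hω.vertical_atTop.eventually (eventually_le_nhds zero_lt_one))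
  obtain ⟨X₂, hX₂⟩ := eventually_atBot.1
    (hω.vertical_atBot.eventually (eventually_le_nhds zero_lt_one))
  set a := X₂ - d / 2 with ha
  set b := X₁ + d / 2 with hb
  have hK : IsCompact (Icc a b ×ℂ Icc (-(d / 2)) (d / 2)) := isCompact_Icc.reProdIm isCompact_Icc
  have hKs : Icc a b ×ℂ Icc (-(d / 2)) (d / 2) ⊆ strip d := fun z hz =>
    (abs_le.2 hz.2).trans_lt (half_lt_self hd)
  obtain ⟨M₁, hM₁⟩ := hK.exists_bound_of_continuousOn (hω.analytic.continuousOn.mono hKs)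
  set c := d / 2 / 2 * (2 * Real.pi) * (d / 2 / 2) with hcd
  have hc : 0 < c := by positivity
  refine ⟨max M₁ (d / c), fun z hz => ?_⟩
  by_cases hab : z.re ∈ Icc a b
  · exact (hM₁ z ⟨hab, abs_le.1 hz⟩).trans (le_max_left _ _)
  · refine le_trans ?_ (le_max_right _ _)
    have h := enorm_mul_le_of_lintegral_vertical_le hd hω.analytic hz fun x hx => by
      rcases lt_or_ge z.re a with h1 | h1
      · exact hX₂ x (by linarith [hx.2])
      · have : b < z.re := by
          by_contra! h2
          exact hab ⟨h1, h2⟩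
        exact hX₁ x (by linarith [hx.1])
    rw [← ofReal_norm, ← ENNReal.ofReal_mul (by positivity), ← ENNReal.ofReal_mul (by positivity),
      ← ENNReal.ofReal_mul (by positivity), ENNReal.ofReal_le_ofReal_iff hd.le] at h
    rw [le_div_iff₀ hc, hcd]
    linarith

/-! ### Quadrature error on the interval and truncation error -/

-- The rule is exact on the Chebyshev sum, so only the remainder contributes: through the absolute
-- weights, and through an integral over length `2`.
open Polynomial.Chebyshev in
theorem norm_scaledQuadrature_sub_integral_le {s : Finset ℝ} (hs : ∀ x ∈ s, x ∈ Icc (-1 : ℝ) 1)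
    {T ε : ℝ} (hT : 0 < T) {f : ℂ → ℂ} (hf : Continuous fun x : ℝ => f x) {a : ℕ → ℂ}
    (h : ∀ x ∈ Icc (-1 : ℝ) 1,
      ‖f (T * x) - ∑ k ∈ Finset.range s.card, a k * ((Polynomial.Chebyshev.T ℝ k).eval x : ℝ)‖ ≤ ε) :
    ‖scaledQuadrature s T f - ∫ x in (-T)..T, f x‖ ≤
      T * (∑ x ∈ s, |interpolatoryWeight s x| + 2) * ε := by
  set P : ℝ → ℂ :=
    fun x => ∑ k ∈ Finset.range s.card, a k * ((Polynomial.Chebyshev.T ℝ k).eval x : ℝ) with hP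
  have hPc : Continuous P := by
    refine continuous_finsetSum _ fun k _ => continuous_const.mul ?_
    exact Complex.continuous_ofReal.comp (Polynomial.continuous _)
  have hfc : Continuous fun x : ℝ => f (T * x) := by
    have := hf.comp (continuous_const_mul T)
    simpa [Function.comp_def] using this
  have hexact : ∑ x ∈ s, (interpolatoryWeight s x : ℂ) * P x = ∫ t in (-1 : ℝ)..1, P t := by
    simp only [hP]
    have hk : ∀ k : ℕ, Continuous fun x : ℝ =>
        a k * ((Polynomial.Chebyshev.T ℝ k).eval x : ℝ) := fun k =>
      continuous_const.mul (Complex.continuous_ofReal.comp (Polynomial.continuous _))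
    rw [intervalIntegral.integral_finsetSum fun k _ => (hk k).intervalIntegrable _ _]
    simp only [Finset.mul_sum]
    rw [Finset.sum_comm]
    refine Finset.sum_congr rfl fun k hk => ?_
    rw [intervalIntegral.integral_const_mul, intervalIntegral.integral_ofReal,
      ← sum_interpolatoryWeight_mul_eval (s := s), Complex.ofReal_sum, Finset.mul_sum]
    · refine Finset.sum_congr rfl fun x _ => ?_
      push_cast
      ring
    · rw [degree_T]
      simpa using hk
  have hint : ∫ x in (-T)..T, f x = T * ∫ t in (-1 : ℝ)..1, f (T * t) := by
    have := intervalIntegral.smul_integral_comp_mul_left (a := (-1 : ℝ)) (b := 1)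
      (fun x : ℝ => f x) T
    rw [mul_neg_one, mul_one] at this
    rw [← this, Complex.real_smul]
    simp only [Complex.ofReal_mul]
  have hsplit : scaledQuadrature s T f - ∫ x in (-T)..T, f x =
      T * (∑ x ∈ s, (interpolatoryWeight s x : ℂ) * (f (T * x) - P x) -
        ∫ t in (-1 : ℝ)..1, (f (T * t) - P t)) := by
    rw [hint, intervalIntegral.integral_sub (hfc.intervalIntegrable _ _)
      (hPc.intervalIntegrable _ _), ← hexact, scaledQuadrature]
    simp only [mul_sub, Finset.sum_sub_distrib, Finset.mul_sum, Complex.ofReal_mul]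
    simp only [mul_assoc]
    ring
  rw [hsplit, norm_mul, Complex.norm_real, Real.norm_of_nonneg hT.le, mul_assoc]
  refine mul_le_mul_of_nonneg_left ((norm_sub_le _ _).trans ?_) hT.le
  rw [add_mul, Finset.sum_mul]
  refine add_le_add ((norm_sum_le _ _).trans (Finset.sum_le_sum fun x hx => ?_)) ?_
  · rw [norm_mul, Complex.norm_real, Real.norm_eq_abs]
    exact mul_le_mul_of_nonneg_left (h x (hs x hx)) (abs_nonneg _)
  · refine (intervalIntegral.norm_integral_le_of_norm_le_const fun t ht => ?_).trans (b := ε * |1 - -1|) ?_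
    · rw [uIoc_of_le (by norm_num)] at ht
      exact h t (Ioc_subset_Icc_self ht)
    · rw [show (1 : ℝ) - -1 = 2 by norm_num, abs_two, mul_comm]

theorem integrable_exp_neg_mul_abs {c : ℝ} (hc : 0 < c) :
    Integrable (fun x : ℝ => Real.exp (-c * |x|)) := by
  rw [← integrableOn_univ, ← Iic_union_Ioi (a := (0 : ℝ))]
  refine IntegrableOn.union ?_ ?_
  · refine (integrableOn_exp_mul_Iic hc 0).congr_fun (fun x hx => ?_) measurableSet_Iic
    simp [abs_of_nonpos (show x ≤ 0 from hx)]
  · refine (integrableOn_exp_mul_Ioi (neg_lt_zero.2 hc) 0).congr_fun (fun x hx => ?_)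
      measurableSet_Ioi
    simp [abs_of_pos (show 0 < x from hx)]

/-- Outside `[-T, T]` the exponent is halved: one half, bounded below linearly, ensures
integrability; the other is at least `E T / 2` by monotonicity. -/
theorem norm_integral_sub_intervalIntegral_le {f : ℝ → ℂ} (hf : Continuous f) {E : ℝ → ℝ}
    {α c c' T : ℝ} (hE : MonotoneOn E (Ici 0)) (hc : 0 < c) (hlow : ∀ x, 0 ≤ x → c * x - c' ≤ E x)
    (hα : 0 ≤ α) (hup : ∀ x, ‖f x‖ ≤ α * Real.exp (-E |x|)) (hT : 0 ≤ T) :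
    ‖(∫ x in (-T)..T, f x) - ∫ x, f x‖ ≤
      (∫ x, α * Real.exp (c' / 2) * Real.exp (-(c / 2) * |x|)) * Real.exp (-(E T / 2)) := by
  have hexp := (integrable_exp_neg_mul_abs (half_pos hc)).const_mul (α * Real.exp (c' / 2))
  have hfi : Integrable f := by
    refine ((integrable_exp_neg_mul_abs hc).const_mul (α * Real.exp c')).mono'
      hf.aestronglyMeasurable (Eventually.of_forall fun x => (hup x).trans ?_)
    rw [mul_assoc, ← Real.exp_add]
    refine mul_le_mul_of_nonneg_left (Real.exp_le_exp.2 ?_) hα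
    linarith [hlow |x| (abs_nonneg x)]
  rw [intervalIntegral.integral_of_le (by linarith),
    ← integral_add_compl (measurableSet_Ioc (a := -T) (b := T)) hfi, sub_add_cancel_left, norm_neg,
    ← integral_mul_const]
  refine (norm_integral_le_of_norm_le (hexp.mul_const _).integrableOn
    (g := fun x => α * Real.exp (c' / 2) * Real.exp (-(c / 2) * |x|) * Real.exp (-(E T / 2)))
    ?_).trans ?_
  · refine (ae_restrict_iff' measurableSet_Ioc.compl).2 (Eventually.of_forall fun x hx => ?_)
    have hx' : T ≤ |x| := by
      by_contra! h
      exact hx ⟨(abs_lt.1 h).1, (abs_lt.1 h).2.le⟩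
    refine (hup x).trans ?_
    rw [mul_assoc, mul_assoc, ← Real.exp_add, ← Real.exp_add]
    refine mul_le_mul_of_nonneg_left (Real.exp_le_exp.2 ?_) hα
    linarith [hlow |x| (abs_nonneg x), hE (mem_Ici.2 hT) (mem_Ici.2 (abs_nonneg x)) hx']
  · refine setIntegral_le_integral (hexp.mul_const _) (Eventually.of_forall fun x => ?_)
    simp only [Pi.zero_apply]
    positivity

theorem Real.sinh_le_two_mul {x : ℝ} (h0 : 0 ≤ x) (h1 : x ≤ 1) : Real.sinh x ≤ 2 * x := by
  have h2 := (abs_le.1 (Real.abs_exp_sub_one_sub_id_le (abs_le.2 ⟨by linarith, h1⟩))).2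
  have h3 := Real.add_one_le_exp (-x)
  rw [Real.sinh_eq]
  nlinarith

theorem Real.half_le_one_sub_exp_neg {x : ℝ} (h0 : 0 ≤ x) (h1 : x ≤ 1) :
    x / 2 ≤ 1 - Real.exp (-x) := by
  have h2 := Real.add_one_le_exp x
  have h3 : Real.exp (-x) * Real.exp x = 1 := by rw [← Real.exp_add]; simp
  have h4 := Real.exp_pos (-x)
  nlinarith

theorem abs_im_cos_le {z : ℂ} {η : ℝ} (hz : |z.im| ≤ η) (h1 : η ≤ 1) :
    |(Complex.cos z).im| ≤ 2 * η := by
  have h : (Complex.cos z).im = -(Real.sin z.re * Real.sinh z.im) := by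
    rw [Complex.cos_eq z, ← Complex.ofReal_cos, ← Complex.ofReal_sin, ← Complex.ofReal_cosh,
      ← Complex.ofReal_sinh]
    simp only [Complex.sub_im, Complex.mul_im, Complex.I_im, Complex.I_re, Complex.ofReal_im,
      Complex.ofReal_re, mul_zero, zero_mul, mul_one, add_zero, zero_sub, Complex.mul_re, sub_zero]
  rw [h, abs_neg, abs_mul, Real.abs_sinh]
  have h2 := Real.sinh_le_two_mul (abs_nonneg _) (hz.trans h1)
  have h3 := Real.sinh_nonneg_iff.2 (abs_nonneg z.im)
  nlinarith [Real.abs_sin_le_one z.re]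

theorem norm_le_of_hardyNorm_le_one {d : ℝ} {ω f : ℂ → ℂ} (hω : IsWeightFunction d ω)
    (hf : hardyNorm d ω f ≤ 1) {z : ℂ} (hz : z ∈ strip d) : ‖f z‖ ≤ ‖ω z‖ := by
  have h : ‖f z / ω z‖ₑ ≤ 1 :=
    (le_iSup₂ (f := fun z (_ : z ∈ strip d) => ‖f z / ω z‖ₑ) z hz).trans hf
  rw [← ofReal_norm, ENNReal.ofReal_le_one, norm_div,
    div_le_one (norm_pos_iff.2 (hω.ne_zero z hz))] at h
  exact h

theorem IsWeightFunction.norm_ofReal {d : ℝ} {ω : ℂ → ℂ} (hω : IsWeightFunction d ω) (x : ℝ) :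
    ‖ω x‖ = (ω x).re := by
  rw [← Complex.abs_re_eq_norm.2 (hω.im_eq_zero x), abs_of_pos (hω.pos x)]

/-- Error of an interpolatory rule on the interval of integration. -/
theorem norm_scaledQuadrature_sub_integral_le_of_strip {d : ℝ} {f : ℂ → ℂ}
    (hf : AnalyticOnNhd ℂ f (strip d)) (hd : 0 < d) {M : ℝ} (hM : ∀ z : ℂ, |z.im| ≤ d / 2 → ‖f z‖ ≤ M)
    {s : Finset ℝ} (hs : ∀ x ∈ s, x ∈ Icc (-1 : ℝ) 1) {n : ℕ} (hn : 2 ≤ n) (hcard : s.card = n)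
    (hW : ∑ x ∈ s, |interpolatoryWeight s x| ≤ 4 * n)
    {T r : ℝ} (hr : 0 < r) (hrd : r ≤ d / 4) (hrT : r ≤ T) :
    ‖scaledQuadrature s T f - ∫ x in (-T)..T, f x‖ ≤
      20 * M / r * T ^ 2 * n * Real.exp (-(r * (n / T))) := by
  have hT : 0 < T := hr.trans_le hrT
  have hη : 0 < r / T := by positivity
  have hη1 : r / T ≤ 1 := (div_le_one hT).2 hrT
  have hM0 : 0 ≤ M := (norm_nonneg _).trans (hM 0 (by simpa using (half_pos hd).le))
  have hn' : (2 : ℝ) ≤ n := by exact_mod_cast hn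
  -- The scaled ellipse has imaginary parts at most `2 * r`, which is why `r ≤ d / 4` is required.
  have him : ∀ z : ℂ, |z.im| ≤ r / T → |((T : ℂ) * Complex.cos z).im| ≤ d / 2 := by
    intro z hz
    rw [Complex.im_ofReal_mul, abs_mul, abs_of_pos hT]
    calc T * |(Complex.cos z).im| ≤ T * (2 * (r / T)) :=
          mul_le_mul_of_nonneg_left (abs_im_cos_le hz hη1) hT.le
      _ = 2 * r := by field_simp
      _ ≤ d / 2 := by linarith
  have hmem : ∀ z : ℂ, |z.im| ≤ d / 2 → z ∈ strip d := fun z hz => hz.trans_lt (half_lt_self hd)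
  obtain ⟨a, ha⟩ := exists_chebyshev_approx (F := fun w => f (T * w)) (M := M) hη
    (fun z hz => by
      have h1 := (hf _ (hmem _ (him z hz))).differentiableAt
      exact DifferentiableAt.comp (f := fun w : ℂ => (T : ℂ) * w) (Complex.cos z) h1 (by fun_prop))
    (fun z hz => hM _ (him z hz))
  have hcont : Continuous fun x : ℝ => f x := by
    rw [continuous_iff_continuousAt]
    intro x
    exact ContinuousAt.comp (f := fun x : ℝ => (x : ℂ))
      (hf x (hmem _ (by simpa using (half_pos hd).le))).continuousAt Complex.continuous_ofReal.continuousAt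
  have h := norm_scaledQuadrature_sub_integral_le hs hT hcont (a := a)
    (hcard ▸ ha n (by omega))
  refine h.trans ?_
  have h1 : Real.exp (-(r / T)) ^ n = Real.exp (-(r * (n / T))) := by
    rw [← Real.exp_nat_mul]
    congr 1
    ring
  have h2 := Real.half_le_one_sub_exp_neg hη.le hη1
  rw [hcard, h1]
  -- Here `4 * n + 2 ≤ 5 * n` because `n ≥ 2`; the geometric series denominator is at least `r / T /
  -- 2`.
  calc _ ≤ T * (5 * n) * (2 * M * Real.exp (-(r * (n / T))) / (r / T / 2)) := by
        have h3 : 0 < r / T / 2 := by positivity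
        gcongr
        · exact div_nonneg (by positivity) (h3.le.trans h2)
        · linarith
    _ = _ := by field_simp; ring

theorem worstCaseError_scaledQuadrature_le {d : ℝ} (hd : 0 < d) {ω : ℂ → ℂ}
    (hω : IsWeightFunction d ω) {M : ℝ} (hM : ∀ z : ℂ, |z.im| ≤ d / 2 → ‖ω z‖ ≤ M)
    {E : ℝ → ℝ} {α c c' : ℝ} (hE : MonotoneOn E (Ici 0)) (hc : 0 < c)
    (hlow : ∀ x, 0 ≤ x → c * x - c' ≤ E x) (hα : 0 ≤ α)
    (hup : ∀ x : ℝ, (ω x).re ≤ α * Real.exp (-E |x|))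
    {s : Finset ℝ} (hs : ∀ x ∈ s, x ∈ Icc (-1 : ℝ) 1) {n : ℕ} (hn : 2 ≤ n) (hcard : s.card = n)
    (hW : ∑ x ∈ s, |interpolatoryWeight s x| ≤ 4 * n)
    {T r : ℝ} (hr : 0 < r) (hrd : r ≤ d / 4) (hrT : r ≤ T) :
    worstCaseError d ω (scaledQuadrature s T) ≤
      ENNReal.ofReal (20 * M / r * T ^ 2 * n * Real.exp (-(r * (n / T))) +
        (∫ x, α * Real.exp (c' / 2) * Real.exp (-(c / 2) * |x|)) * Real.exp (-(E T / 2))) := by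
  refine iSup₂_le fun f hf => ?_
  obtain ⟨⟨hfa, -⟩, hf1⟩ := hf
  have hreal : ∀ x : ℝ, (x : ℂ) ∈ strip d := fun x => by simpa [strip] using hd
  have hcont : Continuous fun x : ℝ => f x := by
    rw [continuous_iff_continuousAt]
    intro x
    exact ContinuousAt.comp (f := fun x : ℝ => (x : ℂ))
      (hfa x (hreal x)).continuousAt Complex.continuous_ofReal.continuousAt
  rw [← ofReal_norm]
  refine ENNReal.ofReal_le_ofReal ((norm_sub_le_norm_sub_add_norm_sub _
    (∫ x in (-T)..T, f x) _).trans (add_le_add ?_ ?_))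
  · exact norm_scaledQuadrature_sub_integral_le_of_strip hfa hd (fun z hz =>
      (norm_le_of_hardyNorm_le_one hω hf1 (hz.trans_lt (half_lt_self hd))).trans (hM z hz))
      hs hn hcard hW hr hrd hrT
  · refine norm_integral_sub_intervalIntegral_le hcont hE hc hlow hα (fun x => ?_)
      (hr.le.trans hrT)
    refine (norm_le_of_hardyNorm_le_one hω hf1 (hreal x)).trans ?_
    rw [hω.norm_ofReal]
    exact hup x

/-! ### Balancing the two errors -/

/-- The sixth-order term of the exponential series dominates `(A * m) ^ 6`. This absorbs the
prefactor `T ^ 2 * n`, which is `O(n ^ 3)`. -/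
theorem pow_three_le_mul_exp {x m A δ : ℝ} (hx : 0 ≤ x) (hm : 0 ≤ m) (hδ : 0 < δ)
    (h : √x ≤ A * m) : x ^ 3 ≤ A ^ 6 * (720 / δ ^ 6) * Real.exp (δ * m) := by
  have h1 : x ^ 3 ≤ (A * m) ^ 6 := by
    calc x ^ 3 = √x ^ 6 := by rw [show 6 = 2 * 3 by norm_num, pow_mul, Real.sq_sqrt hx]
      _ ≤ _ := pow_le_pow_left₀ (Real.sqrt_nonneg _) h 6
  have h2 := Real.pow_div_factorial_le_exp (δ * m) (by positivity) 6
  rw [show ((Nat.factorial 6 : ℕ) : ℝ) = 720 by norm_num [Nat.factorial], mul_pow] at h2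
  calc x ^ 3 ≤ (A * m) ^ 6 := h1
    _ = A ^ 6 * (720 / δ ^ 6) * (δ ^ 6 * m ^ 6 / 720) := by field_simp
    _ ≤ _ := by gcongr

/-- The common form of both decay types: `m` is the rate, bounded by multiples of both the
quadrature exponent `n / T` and the truncation exponent `E T`. -/
theorem exists_worstCaseError_le {d : ℝ} (hd : 0 < d) {ω : ℂ → ℂ} (hω : IsWeightFunction d ω)
    {E : ℝ → ℝ} {α c c' : ℝ} (hE : MonotoneOn E (Ici 0)) (hc : 0 < c)
    (hlow : ∀ x, 0 ≤ x → c * x - c' ≤ E x) (hα : 0 ≤ α)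
    (hup : ∀ x : ℝ, (ω x).re ≤ α * Real.exp (-E |x|))
    {T m : ℕ → ℝ} {t B κ A : ℝ} (ht : 0 < t) (hκ : 0 < κ) (hm : ∀ n, 2 ≤ n → 0 ≤ m n)
    (htT : ∀ n, 2 ≤ n → t ≤ T n) (hTB : ∀ n : ℕ, 2 ≤ n → T n ≤ B * n)
    (hnT : ∀ n : ℕ, 2 ≤ n → κ * m n ≤ n / T n) (hA : ∀ n : ℕ, 2 ≤ n → √n ≤ A * m n)
    (hET : ∀ n, 2 ≤ n → κ * m n ≤ E (T n)) :
    ∃ C : ℝ, 0 < C ∧ ∃ K : ℝ, 0 < K ∧ ∀ n : ℕ, 2 ≤ n →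
      worstCaseError d ω (gaussLegendre n (T n)) ≤
        ENNReal.ofReal (K * Real.exp (-C * m n)) ∧
      worstCaseError d ω (clenshawCurtis n (T n)) ≤
        ENNReal.ofReal (K * Real.exp (-C * m n)) := by
  obtain ⟨M, hM⟩ := hω.classB.exists_norm_le hd
  have hM0 : 0 ≤ M := (norm_nonneg _).trans (hM 0 (by simpa using (half_pos hd).le))
  set r := min (d / 4) t with hr
  have hr0 : 0 < r := lt_min (by positivity) ht
  set I := ∫ x : ℝ, α * Real.exp (c' / 2) * Real.exp (-(c / 2) * |x|)
  have hI : 0 ≤ I := integral_nonneg fun x => by positivity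
  -- Half of the quadrature exponent `r * κ`; the other half pays for `n ^ 3`.
  set δ := r * κ / 2 with hδ
  have hδ0 : 0 < δ := by positivity
  set C := min δ (κ / 2)
  set K₀ := 20 * M / r * B ^ 2 * (A ^ 6 * (720 / δ ^ 6)) with hK₀
  have hK₀0 : 0 ≤ K₀ := by positivity
  have key : ∀ n : ℕ, 2 ≤ n →
      20 * M / r * T n ^ 2 * n * Real.exp (-(r * (n / T n))) + I * Real.exp (-(E (T n) / 2)) ≤
        (K₀ + I + 1) * Real.exp (-C * m n) := by
    intro n hn
    have hT : 0 < T n := ht.trans_le (htT n hn)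
    have h1 : T n ^ 2 ≤ (B * n) ^ 2 := pow_le_pow_left₀ hT.le (hTB n hn) 2
    have h2 := pow_three_le_mul_exp (Nat.cast_nonneg n) (hm n hn) hδ0 (hA n hn)
    have h3 : Real.exp (-(r * (n / T n))) ≤ Real.exp (-(2 * δ) * m n) := by
      refine Real.exp_le_exp.2 ?_
      have := mul_le_mul_of_nonneg_left (hnT n hn) hr0.le
      rw [hδ]; linarith
    have h4 : Real.exp (-(E (T n) / 2)) ≤ Real.exp (-C * m n) := by
      refine Real.exp_le_exp.2 ?_
      have := mul_le_mul_of_nonneg_right (min_le_right δ (κ / 2)) (hm n hn)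
      linarith [hET n hn]
    have h5 : Real.exp (-δ * m n) ≤ Real.exp (-C * m n) := by
      refine Real.exp_le_exp.2 ?_
      have := mul_le_mul_of_nonneg_right (min_le_left δ (κ / 2)) (hm n hn)
      linarith
    have h6 : 20 * M / r * T n ^ 2 * n * Real.exp (-(r * (n / T n))) ≤
        K₀ * Real.exp (-δ * m n) := by
      calc _ ≤ 20 * M / r * (B * n) ^ 2 * n * Real.exp (-(2 * δ) * m n) := by gcongr
        _ = 20 * M / r * B ^ 2 * (n : ℝ) ^ 3 * Real.exp (-(2 * δ) * m n) := by ring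
        _ ≤ 20 * M / r * B ^ 2 * (A ^ 6 * (720 / δ ^ 6) * Real.exp (δ * m n)) *
            Real.exp (-(2 * δ) * m n) := by gcongr
        _ = K₀ * (Real.exp (δ * m n) * Real.exp (-(2 * δ) * m n)) := by rw [hK₀]; ring
        _ = _ := by
          rw [← Real.exp_add]
          congr 2
          ring
    have h7 := mul_le_mul_of_nonneg_left h5 hK₀0
    have h8 := mul_le_mul_of_nonneg_left h4 hI
    have h9 := Real.exp_pos (-C * m n)
    linarith
  refine ⟨C, lt_min hδ0 (by positivity), K₀ + I + 1, by positivity, fun n hn => ⟨?_, ?_⟩⟩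
  · refine (worstCaseError_scaledQuadrature_le hd hω hM hE hc hlow hα hup
      (fun x hx => gaussLegendreNodes_subset n hx) hn (card_gaussLegendreNodes n) ?_ hr0
      (min_le_left _ _) ((min_le_right _ _).trans (htT n hn))).trans
      (ENNReal.ofReal_le_ofReal (key n hn))
    rw [sum_abs_interpolatoryWeight_gaussLegendre (by omega)]
    have : (2 : ℝ) ≤ n := by exact_mod_cast hn
    linarith
  · exact (worstCaseError_scaledQuadrature_le hd hω hM hE hc hlow hα hup
      (fun x hx => clenshawCurtisNodes_subset n hx) hn (card_clenshawCurtisNodes n hn)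
      (sum_abs_interpolatoryWeight_clenshawCurtis_le hn) hr0
      (min_le_left _ _) ((min_le_right _ _).trans (htT n hn))).trans
      (ENNReal.ofReal_le_ofReal (key n hn))

theorem mainTheorem1 (d : ℝ) (hd : 0 < d) (ω : ℂ → ℂ) (hω : IsWeightFunction d ω)
    (L : ℝ) (hL : 0 < L) :
    (∀ α₁ α₂ β ρ : ℝ, IsSEType ω α₁ α₂ β ρ →
      ∃ C : ℝ, 0 < C ∧ ∃ K : ℝ, 0 < K ∧ ∀ n : ℕ, 2 ≤ n →
        worstCaseError d ω (gaussLegendre n (L * (n : ℝ) ^ (1 / (ρ + 1)))) ≤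
            ENNReal.ofReal (K * Real.exp (-C * (n : ℝ) ^ (ρ / (ρ + 1)))) ∧
        worstCaseError d ω (clenshawCurtis n (L * (n : ℝ) ^ (1 / (ρ + 1)))) ≤
            ENNReal.ofReal (K * Real.exp (-C * (n : ℝ) ^ (ρ / (ρ + 1))))) ∧
    (∀ α₁ α₂ β₁ β₂ γ : ℝ, IsDEType ω α₁ α₂ β₁ β₂ γ → 1 ≤ γ * L →
      ∃ C : ℝ, 0 < C ∧ ∃ K : ℝ, 0 < K ∧ ∀ n : ℕ, 2 ≤ n →
        worstCaseError d ω (gaussLegendre n (L * Real.log (n : ℝ))) ≤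
            ENNReal.ofReal (K * Real.exp (-C * ((n : ℝ) / Real.log (n : ℝ)))) ∧
        worstCaseError d ω (clenshawCurtis n (L * Real.log (n : ℝ))) ≤
            ENNReal.ofReal (K * Real.exp (-C * ((n : ℝ) / Real.log (n : ℝ))))) := by
  refine ⟨fun α₁ α₂ β ρ h => ?_, fun α₁ α₂ β₁ β₂ γ h hγL => ?_⟩
  · obtain ⟨-, hα₂, hβ, hρ, -, hup⟩ := h
    have hβL : 0 < (β * L) ^ ρ := by positivity
    have hm : ∀ n : ℕ, 2 ≤ n → (n : ℝ) = (n : ℝ) ^ (1 / (ρ + 1)) * (n : ℝ) ^ (ρ / (ρ + 1)) := by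
      intro n hn
      rw [← Real.rpow_add (by positivity), ← add_div, add_comm 1 ρ, div_self (by positivity),
        Real.rpow_one]
    -- With `m = n ^ (ρ / (ρ + 1))`, `n / T = m / L` and `E T = (β * L) ^ ρ * m` exactly. The offset
    -- `c' = 1` covers `β * x ≤ 1`; `A = 1` works because `ρ ≥ 1` makes the exponent of `m` at least
    -- `1 / 2`.
    refine exists_worstCaseError_le hd hω (E := fun x => (β * x) ^ ρ) (c := β) (c' := 1)
      (t := L) (B := L) (κ := min (1 / L) ((β * L) ^ ρ)) (A := 1) (fun x hx y _ hxy => ?_) hβ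
      (fun x hx => ?_) hα₂.le hup hL (by positivity) (fun n _ => by positivity) (fun n hn => ?_)
      (fun n hn => ?_) (fun n hn => ?_) (fun n hn => ?_) (fun n hn => ?_)
    · have hx' : 0 ≤ x := hx
      exact Real.rpow_le_rpow (by positivity) (by gcongr) (by linarith)
    · have hb : 0 ≤ β * x := by positivity
      rcases le_total (β * x) 1 with h1 | h1
      · have := Real.rpow_nonneg hb ρ
        linarith
      · have := Real.self_le_rpow_of_one_le h1 hρ
        linarith
    · have h1 : (1 : ℝ) ≤ n := by exact_mod_cast (by omega : 1 ≤ n)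
      exact le_mul_of_one_le_right hL.le (Real.one_le_rpow h1 (by positivity))
    · have h1 : (1 : ℝ) ≤ n := by exact_mod_cast (by omega : 1 ≤ n)
      refine mul_le_mul_of_nonneg_left ?_ hL.le
      exact Real.rpow_le_self_of_one_le h1 (div_le_one_of_le₀ (by linarith) (by positivity))
    · have h1 : 0 < (n : ℝ) ^ (1 / (ρ + 1)) := by positivity
      refine (mul_le_mul_of_nonneg_right (min_le_left _ _) (by positivity)).trans (le_of_eq ?_)
      rw [div_mul_eq_mul_div, one_mul, div_eq_div_iff hL.ne' (by positivity)]
      linear_combination -L * hm n hn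
    · have h1 : (1 : ℝ) ≤ n := by exact_mod_cast (by omega : 1 ≤ n)
      rw [Real.sqrt_eq_rpow, one_mul]
      refine Real.rpow_le_rpow_of_exponent_le h1 ?_
      rw [div_le_div_iff₀ two_pos (by positivity)]
      linarith
    · refine (mul_le_mul_of_nonneg_right (min_le_right _ _) (by positivity)).trans (le_of_eq ?_)
      rw [← mul_assoc, Real.mul_rpow (x := β * L) (by positivity) (by positivity),
        ← Real.rpow_mul (by positivity),
        one_div_mul_eq_div]
  · obtain ⟨-, hα₂, -, hβ₂, hγ, -, -, hup⟩ := h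
    have hlog : ∀ n : ℕ, 2 ≤ n → Real.log 2 ≤ Real.log n := fun n hn =>
      Real.log_le_log two_pos (by exact_mod_cast hn)
    have hlog2 : 0 < Real.log 2 := Real.log_pos one_lt_two
    -- Here `A = 2` comes from `log n ≤ 2 * √n`. The factor `log 2` in `κ` gives `log 2 * (n / log
    -- n) ≤ n`, and `n ≤ exp (γ * T)` by `γ * L ≥ 1`.
    refine exists_worstCaseError_le hd hω (E := fun x => β₂ * Real.exp (γ * x)) (c := β₂ * γ)
      (c' := 0) (t := L * Real.log 2) (B := L) (κ := min (1 / L) (β₂ * Real.log 2)) (A := 2)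
      (fun x _ y _ hxy => ?_) (by positivity) (fun x hx => ?_) hα₂.le hup (by positivity)
      (by positivity) (fun n hn => ?_) (fun n hn => ?_)
      (fun n hn => ?_) (fun n hn => ?_) (fun n hn => ?_) (fun n hn => ?_)
    · simp only
      gcongr
    · have h1 := Real.add_one_le_exp (γ * x)
      have := mul_le_mul_of_nonneg_left (show γ * x ≤ Real.exp (γ * x) by linarith) hβ₂.le
      linarith
    · have := hlog2.trans_le (hlog n hn)
      positivity
    · exact mul_le_mul_of_nonneg_left (hlog n hn) hL.le
    · exact mul_le_mul_of_nonneg_left (Real.log_le_self (Nat.cast_nonneg n)) hL.le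
    · have := hlog2.trans_le (hlog n hn)
      refine (mul_le_mul_of_nonneg_right (min_le_left _ _) (by positivity)).trans (le_of_eq ?_)
      field_simp
    · have h0 := hlog2.trans_le (hlog n hn)
      have h1 := Real.log_le_rpow_div (Nat.cast_nonneg n) (ε := 1 / 2) (by norm_num)
      rw [← Real.sqrt_eq_rpow] at h1
      rw [← mul_div_assoc, le_div_iff₀ h0]
      have h2 := Real.mul_self_sqrt (Nat.cast_nonneg (α := ℝ) n)
      nlinarith [Real.sqrt_nonneg (n : ℝ)]
    · have h0 := hlog2.trans_le (hlog n hn)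
      have h1 : (1 : ℝ) ≤ n := by exact_mod_cast (by omega : 1 ≤ n)
      refine (mul_le_mul_of_nonneg_right (min_le_right _ _) (by positivity)).trans ?_
      rw [mul_assoc]
      refine mul_le_mul_of_nonneg_left ?_ hβ₂.le
      have h2 : (n : ℝ) ≤ Real.exp (γ * (L * Real.log n)) := by
        calc (n : ℝ) = Real.exp (Real.log n) := (Real.exp_log (by positivity)).symm
          _ ≤ _ := Real.exp_le_exp.2 (by nlinarith)
      refine le_trans ?_ h2
      rw [← mul_div_assoc, div_le_iff₀ h0, mul_comm]
      exact mul_le_mul_of_nonneg_left (hlog n hn) (Nat.cast_nonneg n)
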